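/- Let $R$ be a commutative ring. All functors are covariant functors on the category of commutative $R$-algebras. Let $\mathcal R$ be the functor of rings $\mathcal R(S)=S$. A functor of $\mathcal R$-modules (resp. of commutative $\mathcal R$-algebras) is a functor $\mathbb M$ (resp. $\mathbb A$) such that $\mathbb M(S)$ is an $S$-module (resp. $\mathbb A(S)$ is a commutative $S$-algebra), functorially in $S$. For functors of $\mathcal R$-modules let $\mathbb M^*(S)=\mathrm{Hom}_{\mathcal S}(\mathbb M_{|S},\mathcal R_{|S})$, where $_{|S}$ is the restriction to commutative $S$-algebras and $\mathcal S=\mathcal R_{|S}$; $\mathbb M$ is reflexive if the canonical morphism $\mathbb M\to\mathbb M^{**}$ is an isomorphism. For a commutative $R$-algebra $B$ let $\mathcal B(S)=B\otimes_RS$ be the associated quasi-coherent algebra. A quasi-coherent algebra quotient of $\mathbb A$ is an epimorphism $\mathbb A\to\mathcal B$ of functors of $\mathcal R$-algebras (surjective on every $S$); $\mathbb A$ is pro-quasicoherent if it is the inverse limit of all its quasi-coherent algebra quotients. Let $\mathfrak F$ be the class of essentially free functors of $\mathcal R$-modules, that is, those isomorphic to $\bigcap_{\alpha\in P}\big(\bigoplus_{\alpha}\mathcal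 R\times\prod_{I-\alpha}\mathcal R\big)\subseteq\prod_I\mathcal R$ for some set $I$ and some set $P$ of subsets of $I$. For a functor of commutative $\mathcal R$-algebras $\mathbb A$ let $(\operatorname{Spec}\mathbb A)(S)=\mathrm{Hom}_{\mathcal R\text{-alg}}(\mathbb A,\mathcal S)$, where here $\mathcal S$ is the quasi-coherent $\mathcal R$-algebra $T\mapsto S\otimes_RT$ associated with $S$; for a functor of sets $\mathbb X$ let $\mathbb A_{\mathbb X}(S)=\mathrm{Hom}(\mathbb X_{|S},\mathcal R_{|S})$. $\mathbb X$ is affine if the canonical morphism $\mathbb X\to\operatorname{Spec}\mathbb A_{\mathbb X}$ is an isomorphism and $\mathbb A_{\mathbb X}$ is reflexive. (a) Let $\mathbb A\in\mathfrak F$ be a functor of commutative $\mathcal R$-algebras and let $\{\mathcal A_i\}_i$ be the system of all its quasi-coherent algebra quotients. Then canonically $$\operatorname{Spec}\mathbb A=\varinjlim_i\operatorname{Spec}\mathcal A_i,\qquad \mathbb A_{\operatorname{Spec}\mathcal A_i}=\mathcal A_i,\qquad \mathbb A_{\operatorname{Spec}\mathbb A}=\varprojlim_i\mathcal A_i .$$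 If moreover $\operatorname{Spec}\mathbb A$ is affine, then $\mathbb A_{\operatorname{Spec}\mathbb A}$ is pro-quasicoherent. (b) The functors $\mathbb A\rightsquigarrow\operatorname{Spec}\mathbb A$ and $\mathbb X\rightsquigarrow\mathbb A_{\mathbb X}$ restrict to mutually quasi-inverse anti-equivalences between the category of commutative pro-quasicoherent functors of algebras $\mathbb A\in\mathfrak F$ and the category of affine functors $\mathbb X$ such that $\mathbb A_{\mathbb X}\in\mathfrak F$. For every such $\mathbb A$ the canonical morphism $\mathbb A\to\mathbb A_{\operatorname{Spec}\mathbb A}$ is an isomorphism. -/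

import Mathlib

open CategoryTheory CategoryTheory.Limits Opposite TensorProduct

universe w u

noncomputable section

/-!
Throughout, `R` is a commutative ring in `Type u` and `CommAlgCat.{u} R` is the category of
commutative `R`-algebras. Functors take their values in `Type (u + 1)`, so that the families of all
morphisms between two of them (`𝔸_X`, `M^*`, `Spec A`) are again values of functors. The index sets
and algebras that witness "essentially free" and "quasi-coherent" are in `Type u`, hence every
essentially free functor has values that are, up to bijection, in `Type u`.
-/

/-- A functor of sets on commutative `R`-algebras. -/
abbrev SetFunctor (R : Type u) [CommRing R] := CommAlgCat.{u} R ⥤ Type (u + 1)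

/-- A functor of `𝓡`-modules: every `M(S)` is an `S`-module, functorially in `S`. -/
structure ModFunctor (R : Type u) [CommRing R] where
  obj : CommAlgCat.{u} R → Type w
  [addCommGroup : ∀ S, AddCommGroup (obj S)]
  [module : ∀ S : CommAlgCat.{u} R, Module S (obj S)]
  map : ∀ {S T : CommAlgCat.{u} R}, (S ⟶ T) → (obj S →+ obj T)
  map_smul : ∀ {S T : CommAlgCat.{u} R} (f : S ⟶ T) (s : S) (m : obj S),
    map f (s • m) = f.hom s • map f m
  map_id : ∀ (S : CommAlgCat.{u} R) (m : obj S), map (𝟙 S) m = m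
  map_comp : ∀ {S T U : CommAlgCat.{u} R} (f : S ⟶ T) (g : T ⟶ U) (m : obj S),
    map (f ≫ g) m = map g (map f m)

attribute [instance] ModFunctor.addCommGroup ModFunctor.module

namespace ModFunctor

variable {R : Type u} [CommRing R]

/-- An isomorphism of functors of `𝓡`-modules. -/
structure Equiv (M : ModFunctor.{w} R) (N : ModFunctor.{u} R) where
  app : ∀ S : CommAlgCat.{u} R, M.obj S ≃ₗ[S] N.obj S
  naturality : ∀ {S T : CommAlgCat.{u} R} (f : S ⟶ T) (m : M.obj S),
    app T (M.map f m) = N.map f (app S m)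

variable (M : ModFunctor.{u + 1} R)

/-- The additive group of `M^*(S) = Hom_𝓢(M_{|S}, 𝓢)`. An `S`-algebra is given by a commutative
`R`-algebra `T` with a morphism `f : S ⟶ T`. -/
def dualSubgroup (S : CommAlgCat.{u} R) :
    AddSubgroup (∀ T : CommAlgCat.{u} R, (S ⟶ T) → (M.obj T →ₗ[T] T)) where
  carrier := {φ | ∀ (T T' : CommAlgCat.{u} R) (f : S ⟶ T) (g : T ⟶ T') (m : M.obj T),
    φ T' (f ≫ g) (M.map g m) = g.hom (φ T f m)}
  add_mem' := by
    intro a b ha hb T T' f g m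
    simp [ha T T' f g m, hb T T' f g m]
  zero_mem' := by
    intro T T' f g m
    simp
  neg_mem' := by
    intro a ha T T' f g m
    simp [ha T T' f g m]

/-- `s • φ` is `φ` multiplied, on each `S`-algebra `T`, by the image of `s` in `T`. -/
instance (S : CommAlgCat.{u} R) : Module S (M.dualSubgroup S) where
  smul s φ := ⟨fun T f => f.hom s • φ.1 T f, by
    intro T T' f g m
    simp [φ.2 T T' f g m]⟩
  one_smul φ := by
    apply Subtype.ext; funext T f
    change f.hom 1 • φ.1 T f = _
    simp
  mul_smul s t φ := by
    apply Subtype.ext; funext T f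
    change f.hom (s * t) • φ.1 T f = f.hom s • f.hom t • φ.1 T f
    simp [mul_smul]
  smul_zero s := by
    apply Subtype.ext; funext T f
    change f.hom s • (0 : M.obj T →ₗ[T] T) = 0
    simp
  smul_add s φ ψ := by
    apply Subtype.ext; funext T f
    change f.hom s • (φ.1 T f + ψ.1 T f) = f.hom s • φ.1 T f + f.hom s • ψ.1 T f
    simp
  add_smul s t φ := by
    apply Subtype.ext; funext T f
    change f.hom (s + t) • φ.1 T f = f.hom s • φ.1 T f + f.hom t • φ.1 T f
    simp [add_smul]
  zero_smul φ := by
    apply Subtype.ext; funext T f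
    change f.hom 0 • φ.1 T f = 0
    simp

/-- The dual functor of modules `M^* = ℍom_𝓡(M, 𝓡)`. -/
def dual : ModFunctor.{u + 1} R where
  obj S := M.dualSubgroup S
  map {S S'} h :=
    { toFun := fun φ => ⟨fun T f => φ.1 T (h ≫ f), by
        intro T T' f g m
        simpa using φ.2 T T' (h ≫ f) g m⟩
      map_zero' := rfl
      map_add' := fun _ _ => rfl }
  map_smul {S S'} h s φ := by
    apply Subtype.ext; funext T f
    change (h ≫ f).hom s • φ.1 T (h ≫ f) = f.hom (h.hom s) • φ.1 T (h ≫ f)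
    simp
  map_id S φ := by
    apply Subtype.ext; funext T f
    change φ.1 T (𝟙 S ≫ f) = φ.1 T f
    simp
  map_comp h k φ := by
    apply Subtype.ext; funext T f
    change φ.1 T ((h ≫ k) ≫ f) = φ.1 T (h ≫ k ≫ f)
    simp

/-- The canonical map `M(S) → M^{**}(S)`, given by evaluation. -/
def toBidual (S : CommAlgCat.{u} R) (m : M.obj S) : M.dual.dual.obj S :=
  ⟨fun T f =>
    { toFun := fun φ => φ.1 T (𝟙 T) (M.map f m)
      map_add' := fun _ _ => rfl
      map_smul' := fun _ _ => rfl }, by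
    intro T T' f g φ
    have h := φ.2 T T' (𝟙 T) g (M.map f m)
    rw [← M.map_comp, Category.id_comp] at h
    change φ.1 T' (g ≫ 𝟙 T') (M.map (f ≫ g) m) = g.hom (φ.1 T (𝟙 T) (M.map f m))
    rw [Category.comp_id]
    exact h⟩

/-- `M` is reflexive: the canonical morphism `M → M^{**}` is an isomorphism. -/
def IsReflexive : Prop :=
  ∀ S : CommAlgCat.{u} R, Function.Bijective (M.toBidual S)

/-- For a set `I` and a set `P` of subsets of `I`, the functor
`⋂_{α ∈ P} (⨁_α 𝓡 × ∏_{I - α} 𝓡) ⊆ ∏_I 𝓡`. -/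
def interFree (I : Type u) (P : Set (Set I)) : ModFunctor.{u} R where
  obj S := (show Submodule S (I → S) from
    { carrier := {x | ∀ α ∈ P, {i ∈ α | x i ≠ 0}.Finite}
      zero_mem' := by intro α _; simp
      add_mem' := by
        intro a b ha hb α hα
        refine ((ha α hα).union (hb α hα)).subset ?_
        rintro i ⟨hi, h⟩
        by_cases h0 : a i = 0
        · exact Or.inr ⟨hi, by simpa [h0] using h⟩
        · exact Or.inl ⟨hi, h0⟩
      smul_mem' := by
        intro s a ha α hα
        refine (ha α hα).subset ?_
        rintro i ⟨hi, h⟩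
        exact ⟨hi, fun h0 => h (by simp [h0])⟩ })
  map {S T} f :=
    { toFun := fun x => ⟨fun i => f.hom (x.1 i), by
        intro α hα
        refine (x.2 α hα).subset ?_
        rintro i ⟨hi, h⟩
        exact ⟨hi, fun h0 => h (by simp [h0])⟩⟩
      map_zero' := by apply Subtype.ext; funext i; exact map_zero f.hom
      map_add' := by intro a b; apply Subtype.ext; funext i; exact map_add f.hom _ _ }
  map_smul f s x := by
    apply Subtype.ext; funext i; exact map_mul f.hom _ _
  map_id S x := rfl
  map_comp f g x := rfl

/-- `M` is essentially free, `M ∈ 𝔉`. -/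
def IsEssentiallyFree (M : ModFunctor.{w} R) : Prop :=
  ∃ (I : Type u) (P : Set (Set I)), Nonempty (M.Equiv (interFree I P))

end ModFunctor

/-- A functor of commutative `𝓡`-algebras: every `A(S)` is a commutative `S`-algebra, functorially
in `S`. -/
structure AlgFunctor (R : Type u) [CommRing R] where
  obj : CommAlgCat.{u} R → Type (u + 1)
  [commRing : ∀ S, CommRing (obj S)]
  [algebra : ∀ S : CommAlgCat.{u} R, Algebra S (obj S)]
  map : ∀ {S T : CommAlgCat.{u} R}, (S ⟶ T) → (obj S →+* obj T)
  map_algebraMap : ∀ {S T : CommAlgCat.{u} R} (f : S ⟶ T) (s : S),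
    map f (algebraMap S (obj S) s) = algebraMap T (obj T) (f.hom s)
  map_id : ∀ (S : CommAlgCat.{u} R) (a : obj S), map (𝟙 S) a = a
  map_comp : ∀ {S T U : CommAlgCat.{u} R} (f : S ⟶ T) (g : T ⟶ U) (a : obj S),
    map (f ≫ g) a = map g (map f a)

attribute [instance] AlgFunctor.commRing AlgFunctor.algebra

namespace AlgFunctor

variable {R : Type u} [CommRing R]

/-- A morphism of functors of `𝓡`-algebras. -/
@[ext]
structure Hom (A B : AlgFunctor R) where
  app : ∀ S : CommAlgCat.{u} R, A.obj S →ₐ[S] B.obj S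
  naturality : ∀ {S T : CommAlgCat.{u} R} (f : S ⟶ T) (a : A.obj S),
    app T (A.map f a) = B.map f (app S a)

instance : Category (AlgFunctor R) where
  Hom := Hom
  id A := { app := fun S => AlgHom.id S (A.obj S), naturality := fun _ _ => rfl }
  comp φ ψ :=
    { app := fun S => (ψ.app S).comp (φ.app S)
      naturality := fun f a => by simp [φ.naturality, ψ.naturality] }

/-- The underlying functor of `𝓡`-modules. -/
def toModFunctor (A : AlgFunctor R) : ModFunctor.{u + 1} R where
  obj := A.obj
  map f := (A.map f).toAddMonoidHom
  map_smul f s a := by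
    simp [Algebra.smul_def, A.map_algebraMap]
  map_id := A.map_id
  map_comp := A.map_comp

end AlgFunctor

section QuasiCoherent

variable (R : Type u) [CommRing R]

/-- The quasi-coherent algebra `𝓑` of a commutative `R`-algebra `B`, `𝓑(S) = S ⊗_R B`. -/
def quasiCoherentObj (B : CommAlgCat.{u} R) : AlgFunctor R where
  obj S := ULift.{u + 1} (S ⊗[R] B)
  map f := (ULift.ringEquiv.symm.toRingHom.comp
    (Algebra.TensorProduct.map f.hom (AlgHom.id R B)).toRingHom).comp ULift.ringEquiv.toRingHom
  map_algebraMap f s := by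
    apply ULift.ext
    change Algebra.TensorProduct.map f.hom (AlgHom.id R B) (s ⊗ₜ[R] 1) = f.hom s ⊗ₜ[R] 1
    simp
  map_id S a := by
    apply ULift.ext
    change Algebra.TensorProduct.map (AlgHom.id R S) (AlgHom.id R B) a.down = a.down
    rw [Algebra.TensorProduct.map_id]
    rfl
  map_comp {S T U} f g a := by
    apply ULift.ext
    change Algebra.TensorProduct.map (g.hom.comp f.hom) ((AlgHom.id R B).comp (AlgHom.id R B))
      a.down = _
    rw [Algebra.TensorProduct.map_comp]
    rfl

/-- `B ↦ 𝓑`, from commutative `R`-algebras to functors of commutative `𝓡`-algebras. -/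
def quasiCoherent : CommAlgCat.{u} R ⥤ AlgFunctor R where
  obj := quasiCoherentObj R
  map {B C} h :=
    { app := fun S => (ULift.algEquiv.symm.toAlgHom.comp
        (Algebra.TensorProduct.map (AlgHom.id S S) h.hom)).comp ULift.algEquiv.toAlgHom
      naturality := fun {S T} f a => by
        apply ULift.ext
        change Algebra.TensorProduct.map (AlgHom.id T T) h.hom
          (Algebra.TensorProduct.map f.hom (AlgHom.id R B) a.down) =
          Algebra.TensorProduct.map f.hom (AlgHom.id R C)
            (Algebra.TensorProduct.map (AlgHom.id S S) h.hom a.down)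
        induction a.down using TensorProduct.induction_on with
        | zero => simp
        | tmul x y => simp
        | add x y hx hy => rw [map_add, map_add, map_add, map_add, hx, hy] }
  map_id B := by
    apply AlgFunctor.Hom.ext
    funext S
    apply AlgHom.ext
    intro a
    apply ULift.ext
    change Algebra.TensorProduct.map (AlgHom.id S S) (AlgHom.id R B) a.down = a.down
    rw [Algebra.TensorProduct.map_id]
    rfl
  map_comp {B C D} h k := by
    apply AlgFunctor.Hom.ext
    funext S
    apply AlgHom.ext
    intro a
    apply ULift.ext
    change Algebra.TensorProduct.map ((AlgHom.id S S).comp (AlgHom.id S S)) (k.hom.comp h.hom)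
      a.down = _
    rw [Algebra.TensorProduct.map_comp]
    rfl

/-- `A ↦ Spec A`, where `(Spec A)(S)` is the set of morphisms of functors of `𝓡`-algebras from `A`
to the quasi-coherent algebra `𝓢` of `S`. -/
def specFunctor : (AlgFunctor R)ᵒᵖ ⥤ SetFunctor R :=
  coyoneda ⋙ (Functor.whiskeringLeft _ _ _).obj (quasiCoherent R)

end QuasiCoherent

section Functions

variable {R : Type u} [CommRing R]

/-- The ring of `𝔸_X(S) = Hom(X_{|S}, 𝓡_{|S})`: natural families of maps `X(T) → T`, for all
`S`-algebras `f : S ⟶ T`. -/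
def functionsSubring (X : SetFunctor R) (S : CommAlgCat.{u} R) :
    Subring (∀ T : CommAlgCat.{u} R, (S ⟶ T) → X.obj T → T) where
  carrier := {F | ∀ (T T' : CommAlgCat.{u} R) (f : S ⟶ T) (g : T ⟶ T') (x : X.obj T),
    F T' (f ≫ g) (X.map g x) = g.hom (F T f x)}
  mul_mem' := by
    intro a b ha hb T T' f g x
    simp [ha T T' f g x, hb T T' f g x]
  one_mem' := by intro T T' f g x; simp
  add_mem' := by
    intro a b ha hb T T' f g x
    simp [ha T T' f g x, hb T T' f g x]
  zero_mem' := by intro T T' f g x; simp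
  neg_mem' := by
    intro a ha T T' f g x
    simp [ha T T' f g x]

/-- `s ∈ S` as a constant function on `X_{|S}`. -/
def functionsConst (X : SetFunctor R) (S : CommAlgCat.{u} R) : S →+* functionsSubring X S where
  toFun s := ⟨fun _ f _ => f.hom s, by intro T T' f g x; simp⟩
  map_one' := by apply Subtype.ext; funext T f x; exact map_one f.hom
  map_zero' := by apply Subtype.ext; funext T f x; exact map_zero f.hom
  map_mul' a b := by apply Subtype.ext; funext T f x; exact map_mul f.hom a b
  map_add' a b := by apply Subtype.ext; funext T f x; exact map_add f.hom a b

/-- The functor of functions `𝔸_X = ℍom(X, 𝓡)`. -/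
def functionsObj (X : SetFunctor R) : AlgFunctor R where
  obj S := functionsSubring X S
  algebra S := (functionsConst X S).toAlgebra
  map {S S'} h :=
    { toFun := fun F => ⟨fun T f x => F.1 T (h ≫ f) x, by
        intro T T' f g x
        simpa using F.2 T T' (h ≫ f) g x⟩
      map_one' := rfl
      map_zero' := rfl
      map_mul' := fun _ _ => rfl
      map_add' := fun _ _ => rfl }
  map_algebraMap h s := rfl
  map_id S F := by
    apply Subtype.ext; funext T f x
    change F.1 T (𝟙 S ≫ f) x = F.1 T f x
    rw [Category.id_comp]
  map_comp h k F := by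
    apply Subtype.ext; funext T f x
    change F.1 T ((h ≫ k) ≫ f) x = F.1 T (h ≫ k ≫ f) x
    rw [Category.assoc]

variable (R) in
/-- `X ↦ 𝔸_X`; a morphism `X ⟶ Y` acts by composition. -/
def functionsFunctor : (SetFunctor R)ᵒᵖ ⥤ AlgFunctor R where
  obj X := functionsObj X.unop
  map {X Y} p :=
    { app := fun S =>
        { toFun := fun F => ⟨fun T f y => F.1 T f (p.unop.app T y), by
            intro T T' f g y
            have h := F.2 T T' f g (p.unop.app T y)
            rw [← NatTrans.naturality_apply] at h
            exact h⟩
          map_one' := rfl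
          map_zero' := rfl
          map_mul' := fun _ _ => rfl
          map_add' := fun _ _ => rfl
          commutes' := fun _ => rfl }
      naturality := fun _ _ => rfl }
  map_id _ := rfl
  map_comp _ _ := rfl

/-- Compatibility of a function `F ∈ 𝔸_X(T)` with a morphism `g : U ⟶ V` of `T`-algebras. -/
theorem functionsSubring_apply {X : SetFunctor R} {T U V : CommAlgCat.{u} R}
    (F : functionsSubring X T) (f : T ⟶ U) (g : U ⟶ V) (f' : T ⟶ V) (hf : f ≫ g = f')
    (x : X.obj U) (y : X.obj V) (hy : X.map g x = y) :
    F.1 V f' y = g.hom (F.1 U f x) := by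
  subst hf
  subst hy
  exact F.2 U V f g x

/-- The canonical morphism `X → Spec 𝔸_X`. It sends `x ∈ X(S)` to the evaluation of functions at
`x`, that is, to `𝔸_X(T) → 𝓢(T) = T ⊗_R S`, `F ↦ F(x)`, where `x` also denotes its image in
`X(T ⊗_R S)`. -/
def toSpecFunctions (X : SetFunctor R) :
    X ⟶ (specFunctor R).obj (op ((functionsFunctor R).obj (op X))) where
  app S := TypeCat.ofHom fun x =>
    { app := fun T =>
        { toFun := fun F => ULift.up (F.1 (CommAlgCat.of R (T ⊗[R] S))
            (CommAlgCat.ofHom Algebra.TensorProduct.includeLeft)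
            (X.map (CommAlgCat.ofHom Algebra.TensorProduct.includeRight) x))
          map_one' := rfl
          map_zero' := rfl
          map_mul' := fun _ _ => rfl
          map_add' := fun _ _ => rfl
          commutes' := fun _ => rfl }
      naturality := fun {T T'} h F => by
        apply ULift.ext
        refine functionsSubring_apply F
          (CommAlgCat.ofHom Algebra.TensorProduct.includeLeft)
          (CommAlgCat.ofHom (Algebra.TensorProduct.map h.hom (AlgHom.id R S))) _ ?_ _ _ ?_
        · apply CommAlgCat.hom_ext
          apply AlgHom.ext
          intro t
          change Algebra.TensorProduct.map h.hom (AlgHom.id R S) (t ⊗ₜ[R] 1) = h.hom t ⊗ₜ[R] 1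
          simp
        · change X.map _ (X.map _ x) = X.map _ x
          rw [← Functor.map_comp_apply]
          congr 3
          apply CommAlgCat.hom_ext
          apply AlgHom.ext
          intro t
          change Algebra.TensorProduct.map h.hom (AlgHom.id R S) (1 ⊗ₜ[R] t) = 1 ⊗ₜ[R] t
          simp }
  naturality S S' k := by
    ext x
    apply AlgFunctor.Hom.ext
    funext T
    apply AlgHom.ext
    intro F
    apply ULift.ext
    refine functionsSubring_apply F
      (CommAlgCat.ofHom Algebra.TensorProduct.includeLeft)
      (CommAlgCat.ofHom ((Algebra.TensorProduct.map (AlgHom.id T T) k.hom).restrictScalars R))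
      _ ?_ _ _ ?_
    · apply CommAlgCat.hom_ext
      apply AlgHom.ext
      intro t
      change Algebra.TensorProduct.map (AlgHom.id T T) k.hom (t ⊗ₜ[R] 1) = t ⊗ₜ[R] 1
      simp
    · change _ = X.map _ (X.map k x)
      rw [← Functor.map_comp_apply, ← Functor.map_comp_apply]
      rfl

/-- The value in `T` of `a ∈ A(T)` at a point `x ∈ (Spec A)(T)`: the morphism `x` sends `a` to
`𝓣(T) = T ⊗_R T`, which is mapped to `T` by multiplication. -/
def evalPoint (A : AlgFunctor R) (T : CommAlgCat.{u} R) (x : A ⟶ (quasiCoherent R).obj T) :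
    A.obj T →+* T :=
  ((Algebra.TensorProduct.lmul' R (S := T)).toRingHom.comp ULift.ringEquiv.toRingHom).comp
    (AlgFunctor.Hom.app x T).toRingHom

theorem evalPoint_algebraMap (A : AlgFunctor R) (T : CommAlgCat.{u} R)
    (x : A ⟶ (quasiCoherent R).obj T) (t : T) :
    evalPoint A T x (algebraMap T (A.obj T) t) = t := by
  change Algebra.TensorProduct.lmul' R (S := T)
    (ULift.down (AlgFunctor.Hom.app x T (algebraMap T (A.obj T) t))) = t
  rw [AlgHom.commutes]
  change Algebra.TensorProduct.lmul' R (S := T) (t ⊗ₜ[R] 1) = t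
  simp

theorem evalPoint_map (A : AlgFunctor R) {T T' : CommAlgCat.{u} R} (g : T ⟶ T')
    (x : A ⟶ (quasiCoherent R).obj T) (a : A.obj T) :
    evalPoint A T' (x ≫ (quasiCoherent R).map g) (A.map g a) = g.hom (evalPoint A T x a) := by
  change Algebra.TensorProduct.lmul' R (S := T')
    (Algebra.TensorProduct.map (AlgHom.id T' T') g.hom
      (ULift.down (AlgFunctor.Hom.app x T' (A.map g a)))) = _
  rw [AlgFunctor.Hom.naturality x g]
  change Algebra.TensorProduct.lmul' R (S := T')
    (Algebra.TensorProduct.map (AlgHom.id T' T') g.hom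
      (Algebra.TensorProduct.map g.hom (AlgHom.id R T)
        (ULift.down (AlgFunctor.Hom.app x T a)))) =
    g.hom (Algebra.TensorProduct.lmul' R (S := T) (ULift.down (AlgFunctor.Hom.app x T a)))
  generalize ULift.down (AlgFunctor.Hom.app x T a) = z
  induction z using TensorProduct.induction_on with
  | zero => simp
  | tmul y z => simp
  | add y z hy hz => simp only [map_add, hy, hz]

/-- The canonical morphism `A → 𝔸_{Spec A}`, `a ↦ (x ↦ x(a))`. -/
def toFunctionsSpec (A : AlgFunctor R) :
    A ⟶ (functionsFunctor R).obj (op ((specFunctor R).obj (op A))) where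
  app S :=
    { toFun := fun a => ⟨fun T f x => evalPoint A T x (A.map f a), by
        intro T T' f g x
        change evalPoint A T' (x ≫ (quasiCoherent R).map g) (A.map (f ≫ g) a) = _
        rw [A.map_comp]
        exact evalPoint_map A g x _⟩
      map_one' := by
        apply Subtype.ext; funext T f x
        exact map_one ((evalPoint A T x).comp (A.map f))
      map_zero' := by
        apply Subtype.ext; funext T f x
        exact map_zero ((evalPoint A T x).comp (A.map f))
      map_mul' := fun a b => by
        apply Subtype.ext; funext T f x
        exact map_mul ((evalPoint A T x).comp (A.map f)) a b
      map_add' := fun a b => by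
        apply Subtype.ext; funext T f x
        exact map_add ((evalPoint A T x).comp (A.map f)) a b
      commutes' := fun s => by
        apply Subtype.ext; funext T f x
        change evalPoint A T x (A.map f (algebraMap S (A.obj S) s)) = f.hom s
        rw [A.map_algebraMap]
        exact evalPoint_algebraMap A T x _ }
  naturality {S S'} h a := by
    apply Subtype.ext; funext T f x
    change evalPoint A T x (A.map f (A.map h a)) = evalPoint A T x (A.map (h ≫ f) a)
    rw [A.map_comp]

/-- `X` is an affine functor: the canonical morphism `X → Spec 𝔸_X` is an isomorphism and `𝔸_X` is
a reflexive functor of `𝓡`-modules. -/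
def IsAffineFunctor (X : SetFunctor R) : Prop :=
  IsIso (toSpecFunctions X) ∧ ((functionsFunctor R).obj (op X)).toModFunctor.IsReflexive

end Functions

section Quotients

variable {R : Type u} [CommRing R]

/-- The quasi-coherent algebra quotients of `A`: commutative `R`-algebras `B` with an epimorphism
`A → 𝓑` (surjective on every `S`). A morphism of quotients is a morphism `B → B'` of `R`-algebras
such that `A → 𝓑 → 𝓑'` is the epimorphism `A → 𝓑'`; there is at most one. Since `A` is commutative,
so are all its quasi-coherent algebra quotients. -/
def isQuotient (A : AlgFunctor R) : ObjectProperty (StructuredArrow A (quasiCoherent R)) :=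
  fun q => ∀ S : CommAlgCat.{u} R, Function.Surjective (AlgFunctor.Hom.app q.hom S)

/-- The inverse system of all quasi-coherent algebra quotients of `A`. -/
def quotientDiagram (A : AlgFunctor R) : (isQuotient A).FullSubcategory ⥤ AlgFunctor R :=
  (isQuotient A).ι ⋙ StructuredArrow.proj A (quasiCoherent R) ⋙ quasiCoherent R

/-- The cone over the quasi-coherent algebra quotients of `A` formed by the quotient morphisms. -/
def quotientCone (A : AlgFunctor R) : Cone (quotientDiagram A) where
  pt := A
  π :=
    { app := fun q => q.obj.hom
      naturality := fun _ _ p => (Category.id_comp _).trans (StructuredArrow.w p.hom).symm }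

/-- `A` is pro-quasicoherent: it is the inverse limit of its quasi-coherent algebra quotients. -/
def IsProQuasicoherent (A : AlgFunctor R) : Prop :=
  Nonempty (IsLimit (quotientCone A))

variable (R)

/-- Commutative pro-quasicoherent functors of algebras in `𝔉`. -/
def proQuasicoherentFree : ObjectProperty (AlgFunctor R) :=
  fun A => IsProQuasicoherent A ∧ A.toModFunctor.IsEssentiallyFree

/-- Affine functors `X` with `𝔸_X ∈ 𝔉`. -/
def affineFree : ObjectProperty (SetFunctor R) :=
  fun X => IsAffineFunctor X ∧ ((functionsFunctor R).obj (op X)).toModFunctor.IsEssentiallyFree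

end Quotients

end

/-! The functors `A ↦ Spec A` and `X ↦ 𝔸_X` are contravariantly adjoint: the canonical morphisms
`toFunctionsSpec` and `toSpecFunctions` satisfy both triangle identities, so morphisms `C → 𝔸_X`
correspond to morphisms `X → Spec C`. Hence `𝔸` can turn a colimit description of `Spec A` into a
limit description of `𝔸_{Spec A}`, and the anti-equivalence amounts to finding where the two
canonical morphisms are isomorphisms.

The substance lies in the class `𝔉`. Let `φ` be a linear morphism from an essentially free functor
to `𝓡` or to a quasi-coherent `𝓑`. Apply it to a generic element `∑ X_i e_i` over a polynomial ring,
with `i` running over an admissible support. The value involves finitely many variables, and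
specializing them yields `φ(m) = ∑ m_i φ(e_i)` with finitely many nonzero terms
(`HomOver.exists_finite_dependence`, `HomOver.app_eq_finsum`). Thus `φ` is determined by the basis,
which gives reflexivity. For algebras, `A → 𝓑` is determined by `A(R) → B` and factors through the
image of that map (`exists_factorization_range`).

Every point of `Spec A` therefore comes from a quotient `𝓐_i`, in a universal way, and `Spec A =
colim Spec 𝓐_i`. Since `𝔸_{Spec 𝓑} = 𝓑` by Yoneda, the adjunction gives `𝔸_{Spec A} = lim 𝓐_i`. So
for `A ∈ 𝔉`, being pro-quasicoherent means that `A → 𝔸_{Spec A}` is an isomorphism, and the triangle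
identities give the anti-equivalence. When `Spec A` is affine, the `𝓐_i` are cofinal among the
quotients of `𝔸_{Spec A}`, so the same limit shows that this functor is pro-quasicoherent. -/

noncomputable section

/-! ### The contravariant adjunction between `Spec` and functions -/

section Adjunction

variable {R : Type u} [CommRing R]

theorem AlgFunctor.comp_app_apply {A B C : AlgFunctor R} (φ : A ⟶ B) (ψ : B ⟶ C)
    (S : CommAlgCat.{u} R) (a : A.obj S) :
    AlgFunctor.Hom.app (φ ≫ ψ) S a = AlgFunctor.Hom.app ψ S (AlgFunctor.Hom.app φ S a) := rfl

theorem AlgFunctor.hom_ext_apply {A B : AlgFunctor R} {φ ψ : A ⟶ B}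
    (h : ∀ S a, AlgFunctor.Hom.app φ S a = AlgFunctor.Hom.app ψ S a) : φ = ψ :=
  AlgFunctor.Hom.ext (funext fun S => AlgHom.ext (h S))

theorem AlgFunctor.isIso_of_bijective {A B : AlgFunctor R} (φ : A ⟶ B)
    (h : ∀ S, Function.Bijective (AlgFunctor.Hom.app φ S)) : IsIso φ := by
  let e : ∀ S : CommAlgCat.{u} R, A.obj S ≃ₐ[S] B.obj S := fun S => AlgEquiv.ofBijective _ (h S)
  let ψ : AlgFunctor.Hom B A :=
    { app := fun S => (e S).symm.toAlgHom
      naturality := fun {S T} f b => by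
        apply (h T).1
        change (e T) ((e T).symm (B.map f b)) = _
        rw [AlgFunctor.Hom.naturality φ f, AlgEquiv.apply_symm_apply]
        exact congrArg _ ((e S).apply_symm_apply b).symm }
  refine ⟨ψ, AlgFunctor.hom_ext_apply fun S a => (e S).symm_apply_apply a,
    AlgFunctor.hom_ext_apply fun S b => (e S).apply_symm_apply b⟩

theorem AlgFunctor.bijective_of_isIso {A B : AlgFunctor R} (φ : A ⟶ B) [IsIso φ]
    (S : CommAlgCat.{u} R) : Function.Bijective (AlgFunctor.Hom.app φ S) := by
  refine Function.bijective_iff_has_inverse.2 ⟨AlgFunctor.Hom.app (inv φ) S, fun a => ?_,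
    fun b => ?_⟩
  · rw [← AlgFunctor.comp_app_apply, IsIso.hom_inv_id]; rfl
  · rw [← AlgFunctor.comp_app_apply, IsIso.inv_hom_id]; rfl

/-- Multiplication `(T ⊗ S) ⊗ (T ⊗ S) → T ⊗ S` undoes the two inclusions. -/
theorem lmul'_map_includeRight_map_includeLeft {S T : Type u} [CommRing S] [CommRing T]
    [Algebra R S] [Algebra R T] (z : T ⊗[R] S) :
    Algebra.TensorProduct.lmul' R (S := T ⊗[R] S)
      (Algebra.TensorProduct.map (AlgHom.id (T ⊗[R] S) (T ⊗[R] S))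
        (Algebra.TensorProduct.includeRight : S →ₐ[R] T ⊗[R] S)
        (Algebra.TensorProduct.map (Algebra.TensorProduct.includeLeft : T →ₐ[R] T ⊗[R] S)
          (AlgHom.id R S) z)) = z := by
  induction z using TensorProduct.induction_on with
  | zero => simp
  | tmul x y => simp
  | add x y hx hy => rw [map_add, map_add, map_add, hx, hy]

/-- First triangle identity. A point `x` is recovered by evaluating over `T ⊗ S` and multiplying
back, because `x` is natural along `T → T ⊗ S`. -/
theorem toSpecFunctions_comp_spec_toFunctionsSpec (A : AlgFunctor R) :
    toSpecFunctions ((specFunctor R).obj (op A)) ≫ (specFunctor R).map (toFunctionsSpec A).op =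
      𝟙 _ := by
  ext S x
  apply AlgFunctor.hom_ext_apply
  intro T a
  apply ULift.ext
  change Algebra.TensorProduct.lmul' R (S := T ⊗[R] S)
      (Algebra.TensorProduct.map (AlgHom.id (T ⊗[R] S) (T ⊗[R] S))
        (Algebra.TensorProduct.includeRight : S →ₐ[R] T ⊗[R] S)
        (ULift.down (AlgFunctor.Hom.app x (CommAlgCat.of R (T ⊗[R] S)) (A.map
          (CommAlgCat.ofHom (Algebra.TensorProduct.includeLeft : T →ₐ[R] T ⊗[R] S)) a)))) =
    ULift.down (AlgFunctor.Hom.app x T a)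
  rw [AlgFunctor.Hom.naturality x]
  exact lmul'_map_includeRight_map_includeLeft (ULift.down (AlgFunctor.Hom.app x T a))

/-- Second triangle identity. Naturality of `F` along the multiplication `T ⊗ T → T` carries the
value at the image of `x` in `X(T ⊗ T)` back to the value at `x`. -/
theorem toFunctionsSpec_comp_functions_toSpecFunctions (X : SetFunctor R) :
    toFunctionsSpec ((functionsFunctor R).obj (op X)) ≫
      (functionsFunctor R).map (toSpecFunctions X).op = 𝟙 _ := by
  apply AlgFunctor.hom_ext_apply
  intro S F
  apply Subtype.ext; funext T f x
  refine (functionsSubring_apply (X := X) F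
    (f ≫ CommAlgCat.ofHom (Algebra.TensorProduct.includeLeft : T →ₐ[R] T ⊗[R] T))
    (CommAlgCat.ofHom (Algebra.TensorProduct.lmul' R (S := T))) f ?_
    (X.map (CommAlgCat.ofHom Algebra.TensorProduct.includeRight) x) x ?_).symm
  · apply CommAlgCat.hom_ext
    apply AlgHom.ext
    intro s
    change Algebra.TensorProduct.lmul' R (S := T) (f.hom s ⊗ₜ[R] 1) = f.hom s
    simp
  · rw [← Functor.map_comp_apply]
    refine Eq.trans ?_ (Functor.map_id_apply X T x)
    congr 3
    apply CommAlgCat.hom_ext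
    apply AlgHom.ext
    intro t
    change Algebra.TensorProduct.lmul' R (S := T) (1 ⊗ₜ[R] t) = t
    simp

theorem toFunctionsSpec_naturality {A B : AlgFunctor R} (φ : A ⟶ B) :
    φ ≫ toFunctionsSpec B =
      toFunctionsSpec A ≫ (functionsFunctor R).map ((specFunctor R).map φ.op).op := by
  apply AlgFunctor.hom_ext_apply
  intro S a
  apply Subtype.ext; funext T f x
  change evalPoint B T x (B.map f (AlgFunctor.Hom.app φ S a)) =
    evalPoint B T x (AlgFunctor.Hom.app φ T (A.map f a))
  rw [AlgFunctor.Hom.naturality φ]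

theorem toSpecFunctions_naturality {X Y : SetFunctor R} (p : X ⟶ Y) :
    p ≫ toSpecFunctions Y =
      toSpecFunctions X ≫ (specFunctor R).map ((functionsFunctor R).map p.op).op := by
  ext S x
  apply AlgFunctor.hom_ext_apply
  intro T F
  apply ULift.ext
  change F.1 _ _ (Y.map _ (p.app S x)) = F.1 _ _ (p.app _ (X.map _ x))
  rw [NatTrans.naturality_apply]

/-- The morphism of algebras `C → 𝔸_X` of a morphism `X → Spec C`. -/
def toFunctionsOfSpec {C : AlgFunctor R} {X : SetFunctor R} (p : X ⟶ (specFunctor R).obj (op C)) :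
    C ⟶ (functionsFunctor R).obj (op X) :=
  toFunctionsSpec C ≫ (functionsFunctor R).map p.op

/-- The morphism `X → Spec C` of a morphism of algebras `C → 𝔸_X`. -/
def toSpecOfFunctions {C : AlgFunctor R} {X : SetFunctor R}
    (m : C ⟶ (functionsFunctor R).obj (op X)) : X ⟶ (specFunctor R).obj (op C) :=
  toSpecFunctions X ≫ (specFunctor R).map m.op

theorem toFunctionsOfSpec_toSpecOfFunctions {C : AlgFunctor R} {X : SetFunctor R}
    (m : C ⟶ (functionsFunctor R).obj (op X)) : toFunctionsOfSpec (toSpecOfFunctions m) = m := by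
  rw [toFunctionsOfSpec, toSpecOfFunctions, op_comp, Functor.map_comp, ← Category.assoc,
    ← toFunctionsSpec_naturality, Category.assoc, toFunctionsSpec_comp_functions_toSpecFunctions,
    Category.comp_id]

/-- Transposition turns the equations of a factorization through a colimit of spectra into those of
a factorization through a limit of algebras. The converse direction,
`spec_map_comp_toSpecOfFunctions`, serves for uniqueness. -/
theorem toFunctionsOfSpec_comp_map {A B C : AlgFunctor R} (φ : A ⟶ B) (n : C ⟶ B)
    (p : (specFunctor R).obj (op A) ⟶ (specFunctor R).obj (op C))
    (h : (specFunctor R).map φ.op ≫ p = (specFunctor R).map n.op) :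
    toFunctionsOfSpec p ≫ (functionsFunctor R).map ((specFunctor R).map φ.op).op =
      n ≫ toFunctionsSpec B := by
  rw [toFunctionsOfSpec, Category.assoc, ← Functor.map_comp, ← op_comp, h,
    toFunctionsSpec_naturality]

theorem spec_map_comp_toSpecOfFunctions {A B C : AlgFunctor R} (φ : A ⟶ B) (n : C ⟶ B)
    (m : C ⟶ (functionsFunctor R).obj (op ((specFunctor R).obj (op A))))
    (h : m ≫ (functionsFunctor R).map ((specFunctor R).map φ.op).op = n ≫ toFunctionsSpec B) :
    (specFunctor R).map φ.op ≫ toSpecOfFunctions m = (specFunctor R).map n.op := by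
  rw [toSpecOfFunctions, ← Category.assoc, toSpecFunctions_naturality, Category.assoc,
    ← Functor.map_comp, ← op_comp, h, op_comp, Functor.map_comp, ← Category.assoc,
    toSpecFunctions_comp_spec_toFunctionsSpec, Category.id_comp]

end Adjunction

/-! ### Quasi-coherent algebras: reduction to the values over `R`, and Yoneda -/

section QuasiCoherentAlgebras

variable {R : Type u} [CommRing R]

/-- The initial morphism `R ⟶ T`. -/
def baseHom (T : CommAlgCat.{u} R) : CommAlgCat.of R R ⟶ T :=
  CommAlgCat.ofHom (Algebra.ofId R T)

theorem baseHom_comp {T U : CommAlgCat.{u} R} (g : T ⟶ U) : baseHom T ≫ g = baseHom U := by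
  apply CommAlgCat.hom_ext
  apply AlgHom.ext
  intro r
  exact g.hom.commutes r

instance algebraBase (A : AlgFunctor R) : Algebra R (A.obj (CommAlgCat.of R R)) :=
  A.algebra (CommAlgCat.of R R)

/-- The identification `T ⊗ B = 𝓑(T)`. -/
def qcEquiv (B T : CommAlgCat.{u} R) : T ⊗[R] B ≃ₐ[T] ((quasiCoherent R).obj B).obj T :=
  (ULift.algEquiv (R := T) (A := T ⊗[R] B)).symm

theorem qcEquiv_surjective (B T : CommAlgCat.{u} R) : Function.Surjective (qcEquiv B T) :=
  (qcEquiv B T).surjective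

theorem map_qcEquiv (B : CommAlgCat.{u} R) {T U : CommAlgCat.{u} R} (g : T ⟶ U) (z : T ⊗[R] B) :
    ((quasiCoherent R).obj B).map g (qcEquiv B T z) =
      qcEquiv B U (Algebra.TensorProduct.map g.hom (AlgHom.id R B) z) := rfl

theorem quasiCoherent_map_app_qcEquiv {B C : CommAlgCat.{u} R} (h : B ⟶ C) (T : CommAlgCat.{u} R)
    (z : T ⊗[R] B) :
    AlgFunctor.Hom.app ((quasiCoherent R).map h) T (qcEquiv B T z) =
      qcEquiv C T (Algebra.TensorProduct.map (AlgHom.id T T) h.hom z) := rfl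

/-- This shows that `𝓑(T)` is generated as a `T`-module by the image of `𝓑(R)`, so statements about
`𝓑` can be checked over `R`. -/
theorem qcEquiv_tmul (B T : CommAlgCat.{u} R) (t : T) (b : B) :
    qcEquiv B T (t ⊗ₜ[R] b) = t • ((quasiCoherent R).obj B).map (baseHom T)
      (qcEquiv B (CommAlgCat.of R R) ((1 : R) ⊗ₜ[R] b)) := by
  rw [map_qcEquiv, ← map_smul]
  congr 1
  change t ⊗ₜ[R] b = t • Algebra.TensorProduct.map (Algebra.ofId R T) (AlgHom.id R B)
    ((1 : R) ⊗ₜ[R] b)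
  simp [TensorProduct.smul_tmul']

/-- The morphism of `R`-algebras `A(R) → 𝓑(R) = B` of a morphism `A → 𝓑`. -/
def baseValue {A : AlgFunctor R} {B : CommAlgCat.{u} R} (φ : A ⟶ (quasiCoherent R).obj B) :
    A.obj (CommAlgCat.of R R) →ₐ[R] B :=
  ((Algebra.TensorProduct.lid R B).toAlgHom.comp
    (qcEquiv B (CommAlgCat.of R R)).symm.toAlgHom).comp
      (AlgFunctor.Hom.app φ (CommAlgCat.of R R))

theorem app_base {A : AlgFunctor R} {B : CommAlgCat.{u} R} (φ : A ⟶ (quasiCoherent R).obj B)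
    (a : A.obj (CommAlgCat.of R R)) :
    AlgFunctor.Hom.app φ (CommAlgCat.of R R) a =
      qcEquiv B (CommAlgCat.of R R) ((1 : R) ⊗ₜ[R] baseValue φ a) :=
  (qcEquiv B (CommAlgCat.of R R)).symm.injective
    ((Algebra.TensorProduct.lid R B).symm_apply_apply
      ((qcEquiv B (CommAlgCat.of R R)).symm
        (AlgFunctor.Hom.app φ (CommAlgCat.of R R) a))).symm

theorem app_map_baseHom {A : AlgFunctor R} {B : CommAlgCat.{u} R}
    (φ : A ⟶ (quasiCoherent R).obj B) (T : CommAlgCat.{u} R) (a : A.obj (CommAlgCat.of R R)) :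
    AlgFunctor.Hom.app φ T (A.map (baseHom T) a) =
      qcEquiv B T ((1 : T) ⊗ₜ[R] baseValue φ a) := by
  rw [AlgFunctor.Hom.naturality φ, app_base, qcEquiv_tmul B T, one_smul]

theorem baseValue_comp_map {A : AlgFunctor R} {B C : CommAlgCat.{u} R}
    (φ : A ⟶ (quasiCoherent R).obj B) (h : B ⟶ C) (a : A.obj (CommAlgCat.of R R)) :
    baseValue (φ ≫ (quasiCoherent R).map h) a = h.hom (baseValue φ a) := by
  change Algebra.TensorProduct.lid R C ((qcEquiv C (CommAlgCat.of R R)).symm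
    (AlgFunctor.Hom.app ((quasiCoherent R).map h)
    (CommAlgCat.of R R) (AlgFunctor.Hom.app φ (CommAlgCat.of R R) a))) = _
  rw [app_base φ]
  change Algebra.TensorProduct.lid R C (Algebra.TensorProduct.map (AlgHom.id R R) h.hom
    ((1 : R) ⊗ₜ[R] baseValue φ a)) = _
  simp

theorem baseValue_surjective {A : AlgFunctor R} {B : CommAlgCat.{u} R}
    (φ : A ⟶ (quasiCoherent R).obj B)
    (h : Function.Surjective (AlgFunctor.Hom.app φ (CommAlgCat.of R R))) :
    Function.Surjective (baseValue φ) :=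
  ((Algebra.TensorProduct.lid R B).surjective.comp
    (qcEquiv B (CommAlgCat.of R R)).symm.surjective).comp h

theorem app_surjective_of_baseValue {A : AlgFunctor R} {B : CommAlgCat.{u} R}
    (φ : A ⟶ (quasiCoherent R).obj B) (h : Function.Surjective (baseValue φ))
    (T : CommAlgCat.{u} R) : Function.Surjective (AlgFunctor.Hom.app φ T) := by
  intro y
  obtain ⟨z, rfl⟩ := qcEquiv_surjective B T y
  induction z using TensorProduct.induction_on with
  | zero => exact ⟨0, by simp⟩
  | tmul t b =>
    obtain ⟨a, rfl⟩ := h b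
    refine ⟨t • A.map (baseHom T) a, ?_⟩
    rw [map_smul, app_map_baseHom, ← map_smul, TensorProduct.smul_tmul', smul_eq_mul, mul_one]
  | add x y hx hy =>
    obtain ⟨a, ha⟩ := hx
    obtain ⟨b, hb⟩ := hy
    exact ⟨a + b, by rw [map_add, map_add, ha, hb]⟩

/-- The morphism of `R`-algebras defined by a morphism `𝓑 → 𝓒`. -/
def quasiCoherentPreimage {B C : CommAlgCat.{u} R}
    (φ : (quasiCoherent R).obj B ⟶ (quasiCoherent R).obj C) : B ⟶ C :=
  CommAlgCat.ofHom ((baseValue φ).comp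
    ((qcEquiv B (CommAlgCat.of R R)).toAlgHom.comp
      (Algebra.TensorProduct.lid R B).symm.toAlgHom))

theorem quasiCoherentPreimage_hom_apply {B C : CommAlgCat.{u} R}
    (φ : (quasiCoherent R).obj B ⟶ (quasiCoherent R).obj C) (b : B) :
    (quasiCoherentPreimage φ).hom b =
      baseValue φ (qcEquiv B (CommAlgCat.of R R) ((1 : R) ⊗ₜ[R] b)) := rfl

/-- Fullness of `B ↦ 𝓑`: by linearity and naturality, a morphism out of `𝓑` is fixed by its value
over `R`. In particular, points of `Spec 𝓑` are algebra morphisms out of `B`. -/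
theorem map_quasiCoherentPreimage {B C : CommAlgCat.{u} R}
    (φ : (quasiCoherent R).obj B ⟶ (quasiCoherent R).obj C) :
    (quasiCoherent R).map (quasiCoherentPreimage φ) = φ := by
  apply AlgFunctor.hom_ext_apply
  intro T y
  obtain ⟨z, rfl⟩ := qcEquiv_surjective B T y
  induction z using TensorProduct.induction_on with
  | zero => simp
  | tmul t b =>
    rw [quasiCoherent_map_app_qcEquiv, qcEquiv_tmul B, map_smul, app_map_baseHom,
      ← quasiCoherentPreimage_hom_apply, ← map_smul]
    simp [TensorProduct.smul_tmul']
  | add x y hx hy => rw [map_add, map_add, map_add, hx, hy]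

/-- Yoneda's lemma: over `S`, the functor `Spec 𝓑` is represented by `S ⊗ B`, and a function is its
value at the universal point `r`. -/
instance isIso_toFunctionsSpec_quasiCoherent (B : CommAlgCat.{u} R) :
    IsIso (toFunctionsSpec ((quasiCoherent R).obj B)) := by
  apply AlgFunctor.isIso_of_bijective
  intro S
  let SB : CommAlgCat.{u} R := CommAlgCat.of R (S ⊗[R] B)
  let l : S ⟶ SB := CommAlgCat.ofHom Algebra.TensorProduct.includeLeft
  let r : B ⟶ SB := CommAlgCat.ofHom Algebra.TensorProduct.includeRight
  have key : ∀ z : ((quasiCoherent R).obj B).obj S,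
      (AlgFunctor.Hom.app (toFunctionsSpec ((quasiCoherent R).obj B)) S z).1 SB l
        ((quasiCoherent R).map r) = z.down := fun z =>
    lmul'_map_includeRight_map_includeLeft z.down
  constructor
  · intro z z' h
    apply ULift.ext
    rw [← key z, ← key z', h]
  · intro F
    refine ⟨ULift.up (F.1 SB l ((quasiCoherent R).map r)), ?_⟩
    apply Subtype.ext; funext T f x
    obtain ⟨h, rfl⟩ : ∃ h, x = (quasiCoherent R).map h :=
      ⟨_, (map_quasiCoherentPreimage x).symm⟩
    -- The pair `(f, h)` is the image of the universal pair `(l, r)` under `g`, so naturality of `F`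
    -- along `g` determines its value there.
    let g : SB ⟶ T := CommAlgCat.ofHom
      (Algebra.TensorProduct.lift f.hom h.hom fun _ _ => Commute.all _ _)
    have hF := functionsSubring_apply F l g f (by
      apply CommAlgCat.hom_ext
      apply AlgHom.ext
      intro s
      change Algebra.TensorProduct.lift f.hom h.hom (fun _ _ => Commute.all _ _) (s ⊗ₜ[R] 1) = f.hom s
      simp) ((quasiCoherent R).map r) ((quasiCoherent R).map h) (by
      refine ((quasiCoherent R).map_comp r g).symm.trans ?_
      congr 1
      apply CommAlgCat.hom_ext
      apply AlgHom.ext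
      intro s
      change Algebra.TensorProduct.lift f.hom h.hom (fun _ _ => Commute.all _ _) (1 ⊗ₜ[R] s) = h.hom s
      simp)
    refine Eq.trans ?_ hF.symm
    change Algebra.TensorProduct.lmul' R (S := T) (Algebra.TensorProduct.map (AlgHom.id T T) h.hom
      (Algebra.TensorProduct.map f.hom (AlgHom.id R B) (F.1 SB l ((quasiCoherent R).map r)))) =
      Algebra.TensorProduct.lift f.hom h.hom (fun _ _ => Commute.all _ _) (F.1 SB l ((quasiCoherent R).map r))
    generalize F.1 SB l ((quasiCoherent R).map r) = z
    change S ⊗[R] B at z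
    induction z using TensorProduct.induction_on with
    | zero => simp
    | tmul x y => simp
    | add x y hx hy => rw [map_add, map_add, map_add, map_add, hx, hy]

end QuasiCoherentAlgebras

/-! ### Finiteness over polynomial rings, and coordinates on essentially free functors -/

namespace ModFunctor

universe v

variable {R : Type u} [CommRing R]

/-- Every element of `V` over a polynomial ring involves only finitely many of the variables. -/
def InvolvesFinitelyMany (V : ModFunctor.{v} R) : Prop :=
  ∀ (I : Type u) (T : CommAlgCat.{u} R) (z : V.obj (CommAlgCat.of R (MvPolynomial I T))),
    ∃ F : Set I, F.Finite ∧ ∀ (U : CommAlgCat.{u} R) (f : T →ₐ[R] U) (y y' : I → U),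
      (∀ i ∈ F, y i = y' i) →
        V.map (CommAlgCat.ofHom (MvPolynomial.aevalTower f y)) z =
          V.map (CommAlgCat.ofHom (MvPolynomial.aevalTower f y')) z

variable (R) in
/-- The functor of modules `𝓡`. -/
def structureFunctor : ModFunctor.{u} R where
  obj S := S
  map f := f.hom.toRingHom.toAddMonoidHom
  map_smul f s m := map_mul f.hom s m
  map_id _ _ := rfl
  map_comp _ _ _ := rfl

theorem aevalTower_congr_vars {I : Type u} {T U : Type u} [CommRing T] [Algebra R T] [CommRing U]
    [Algebra R U] (p : MvPolynomial I T) (f : T →ₐ[R] U) (y y' : I → U)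
    (h : ∀ i ∈ p.vars, y i = y' i) :
    MvPolynomial.aevalTower f y p = MvPolynomial.aevalTower f y' p :=
  MvPolynomial.eval₂Hom_congr' rfl (fun i hi _ => h i hi) rfl

theorem involvesFinitelyMany_structureFunctor :
    (structureFunctor R).InvolvesFinitelyMany := by
  intro I T p
  exact ⟨(MvPolynomial.vars (R := T) p : Set I), Finset.finite_toSet _, fun U f y y' h =>
    aevalTower_congr_vars p f y y' h⟩

/-- An element of `T[X_i] ⊗ B` is a finite sum of pure tensors, each with one polynomial factor. -/
theorem involvesFinitelyMany_quasiCoherent (B : CommAlgCat.{u} R) :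
    ((quasiCoherent R).obj B).toModFunctor.InvolvesFinitelyMany := by
  intro I T z
  obtain ⟨z, rfl⟩ := qcEquiv_surjective B _ z
  suffices H : ∃ F : Set I, F.Finite ∧ ∀ (U : CommAlgCat.{u} R) (f : T →ₐ[R] U) (y y' : I → U),
      (∀ i ∈ F, y i = y' i) →
        Algebra.TensorProduct.map (MvPolynomial.aevalTower f y) (AlgHom.id R B) z =
          Algebra.TensorProduct.map (MvPolynomial.aevalTower f y') (AlgHom.id R B) z by
    obtain ⟨F, hF, h⟩ := H
    refine ⟨F, hF, fun U f y y' hy => ?_⟩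
    exact congrArg (qcEquiv B U) (h U f y y' hy)
  induction z using TensorProduct.induction_on with
  | zero => exact ⟨∅, Set.finite_empty, fun U f y y' _ => by simp⟩
  | tmul p b =>
    refine ⟨(MvPolynomial.vars (R := T) p : Set I), Finset.finite_toSet _, fun U f y y' h => ?_⟩
    rw [Algebra.TensorProduct.map_tmul, Algebra.TensorProduct.map_tmul]
    congr 1
    exact aevalTower_congr_vars p f y y' h
  | add x y hx hy =>
    obtain ⟨F, hF, h⟩ := hx
    obtain ⟨G, hG, k⟩ := hy
    refine ⟨F ∪ G, hF.union hG, fun U f y y' hy => ?_⟩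
    rw [map_add, map_add, h U f y y' fun i hi => hy i (Or.inl hi),
      k U f y y' fun i hi => hy i (Or.inr hi)]

/-- The subsets meeting every member of `P` in a finite set. -/
def perp {I : Type u} (P : Set (Set I)) : Set (Set I) :=
  {J | ∀ α ∈ P, {i ∈ α | i ∈ J}.Finite}

theorem subset_perp_perp {I : Type u} (P : Set (Set I)) : P ⊆ perp (perp P) := by
  intro α hα J hJ
  exact (hJ α hα).subset fun i hi => ⟨hi.2, hi.1⟩

/-- The element of `interFree I P` with given coordinates supported in a set of `perp P`. -/
def interFreeMk {I : Type u} {P : Set (Set I)} {S : CommAlgCat.{u} R} (x : I → S) {J : Set I}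
    (hJ : J ∈ perp P) (hx : ∀ i, i ∉ J → x i = 0) : (interFree I P : ModFunctor R).obj S :=
  ⟨x, fun α hα => (hJ α hα).subset fun i hi =>
    ⟨hi.1, Classical.byContradiction fun h => hi.2 (hx i h)⟩⟩

theorem perp_of_finite {I : Type u} (P : Set (Set I)) {J : Set I} (hJ : J.Finite) : J ∈ perp P :=
  fun _ _ => hJ.subset fun _ hi => hi.2

open scoped Classical in
/-- The basis vectors of `interFree I P`. -/
def interFreeSingle {I : Type u} (P : Set (Set I)) (S : CommAlgCat.{u} R) (i : I) :
    (interFree I P : ModFunctor R).obj S :=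
  interFreeMk (Pi.single i 1) (perp_of_finite P (Set.finite_singleton i)) fun _ hj =>
    Pi.single_eq_of_ne hj 1

theorem map_interFreeSingle {I : Type u} (P : Set (Set I)) {S T : CommAlgCat.{u} R} (f : S ⟶ T)
    (i : I) :
    (interFree I P : ModFunctor R).map f (interFreeSingle P S i) = interFreeSingle P T i := by
  classical
  apply Subtype.ext
  funext j
  change f.hom ((Pi.single i 1 : I → S) j) = (Pi.single i 1 : I → T) j
  rcases eq_or_ne j i with rfl | h
  · simp
  · rw [Pi.single_eq_of_ne h, Pi.single_eq_of_ne h, map_zero]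

section Coordinates

variable {M : ModFunctor.{w} R} {I : Type u} {P : Set (Set I)} (e : M.Equiv (interFree I P))

theorem Equiv.symm_naturality {S T : CommAlgCat.{u} R} (f : S ⟶ T)
    (x : (interFree I P : ModFunctor R).obj S) :
    (e.app T).symm ((interFree I P : ModFunctor R).map f x) = M.map f ((e.app S).symm x) := by
  apply (e.app T).injective
  rw [LinearEquiv.apply_symm_apply, e.naturality, LinearEquiv.apply_symm_apply]

/-- The coordinates of an element of an essentially free functor. -/
def Equiv.coord (S : CommAlgCat.{u} R) (m : M.obj S) (i : I) : S := (e.app S m).1 i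

/-- The basis of an essentially free functor. -/
def Equiv.basis (S : CommAlgCat.{u} R) (i : I) : M.obj S :=
  (e.app S).symm (interFreeSingle P S i)

theorem Equiv.map_basis {S T : CommAlgCat.{u} R} (f : S ⟶ T) (i : I) :
    M.map f (e.basis S i) = e.basis T i := by
  rw [Equiv.basis, Equiv.basis, ← e.symm_naturality, map_interFreeSingle]

theorem Equiv.coord_add (S : CommAlgCat.{u} R) (m n : M.obj S) (i : I) :
    e.coord S (m + n) i = e.coord S m i + e.coord S n i := by
  rw [Equiv.coord, map_add]; rfl

theorem Equiv.coord_smul (S : CommAlgCat.{u} R) (s : S) (m : M.obj S) (i : I) :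
    e.coord S (s • m) i = s * e.coord S m i := by
  rw [Equiv.coord, _root_.map_smul]; rfl

theorem Equiv.coord_map {S T : CommAlgCat.{u} R} (f : S ⟶ T) (m : M.obj S) (i : I) :
    e.coord T (M.map f m) i = f.hom (e.coord S m i) := by
  rw [Equiv.coord, e.naturality]; rfl

theorem Equiv.coord_ext (S : CommAlgCat.{u} R) {m n : M.obj S}
    (h : ∀ i, e.coord S m i = e.coord S n i) : m = n :=
  (e.app S).injective (Subtype.ext (funext h))

open scoped Classical in
theorem Equiv.coord_basis (S : CommAlgCat.{u} R) (i j : I) :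
    e.coord S (e.basis S i) j = (Pi.single i 1 : I → S) j := by
  rw [Equiv.coord, Equiv.basis, LinearEquiv.apply_symm_apply]; rfl

theorem Equiv.coord_mem_perp (S : CommAlgCat.{u} R) (m : M.obj S) :
    {i | e.coord S m i ≠ 0} ∈ perp P := (e.app S m).2

theorem Equiv.coord_symm_mk {S : CommAlgCat.{u} R} (x : I → S) {J : Set I}
    (hJ : J ∈ perp P) (hx : ∀ i, i ∉ J → x i = 0) (i : I) :
    e.coord S ((e.app S).symm (interFreeMk x hJ hx)) i = x i := by
  rw [Equiv.coord, LinearEquiv.apply_symm_apply]; rfl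

theorem Equiv.coord_sum (S : CommAlgCat.{u} R) {ι : Type*} (s : Finset ι) (m : ι → M.obj S)
    (i : I) : e.coord S (∑ k ∈ s, m k) i = ∑ k ∈ s, e.coord S (m k) i := by
  classical
  induction s using Finset.induction_on with
  | empty =>
    rw [Finset.sum_empty, Finset.sum_empty, Equiv.coord, map_zero]; rfl
  | insert k s hk ih => rw [Finset.sum_insert hk, Finset.sum_insert hk, e.coord_add, ih]

end Coordinates

/-- The morphisms of functors of modules `M_{|S} → V_{|S}`. -/
structure HomOver (M : ModFunctor.{w} R) (V : ModFunctor.{v} R) (S : CommAlgCat.{u} R) where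
  app : ∀ T : CommAlgCat.{u} R, (S ⟶ T) → (M.obj T →ₗ[T] V.obj T)
  naturality : ∀ (T T' : CommAlgCat.{u} R) (f : S ⟶ T) (g : T ⟶ T') (m : M.obj T),
    app T' (f ≫ g) (M.map g m) = V.map g (app T f m)

/-! ### Expansion of morphisms along the basis -/

section Expansion

variable {M : ModFunctor.{w} R} {V : ModFunctor.{v} R} {I : Type u} {P : Set (Set I)}
  (e : M.Equiv (interFree I P)) {S : CommAlgCat.{u} R}

/-- Every element supported in `J` is a specialization of one generic element with indeterminate
coordinates on `J`. The image of that element involves a finite set `F` of variables, so `φ` sees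
only the coordinates in `F`. -/
theorem HomOver.exists_finite_dependence (hV : V.InvolvesFinitelyMany) (φ : HomOver M V S)
    {T : CommAlgCat.{u} R} (f : S ⟶ T) {J : Set I} (hJ : J ∈ perp P) :
    ∃ F : Set I, F.Finite ∧ ∀ m m' : M.obj T, (∀ i ∉ J, e.coord T m i = 0) →
      (∀ i ∉ J, e.coord T m' i = 0) → (∀ i ∈ F, e.coord T m i = e.coord T m' i) →
        φ.app T f m = φ.app T f m' := by
  classical
  let T₁ : CommAlgCat.{u} R := CommAlgCat.of R (MvPolynomial I T)
  let c : T ⟶ T₁ := CommAlgCat.ofHom (IsScalarTower.toAlgHom R T (MvPolynomial I T))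
  -- The cutoff outside `J` is what makes the generic element belong to the functor: its support
  -- must lie in `perp P`.
  let y : I → T₁ := fun i => if i ∈ J then (MvPolynomial.X i : MvPolynomial I T) else 0
  let x : M.obj T₁ := (e.app T₁).symm (interFreeMk y hJ fun i hi => if_neg hi)
  obtain ⟨F, hF, h⟩ := hV I T (φ.app T₁ (f ≫ c) x)
  have key : ∀ m : M.obj T, (∀ i ∉ J, e.coord T m i = 0) → φ.app T f m =
      V.map (CommAlgCat.ofHom (MvPolynomial.aevalTower (AlgHom.id R T) (e.coord T m)))
        (φ.app T₁ (f ≫ c) x) := by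
    intro m hm
    let g : T₁ ⟶ T :=
      CommAlgCat.ofHom (MvPolynomial.aevalTower (AlgHom.id R T) (e.coord T m))
    have hg : M.map g x = m := by
      apply e.coord_ext
      intro i
      rw [e.coord_map, e.coord_symm_mk]
      change MvPolynomial.aevalTower (AlgHom.id R T) (e.coord T m)
        (if i ∈ J then (MvPolynomial.X i : MvPolynomial I T) else 0) = _
      split_ifs with hi
      · simp
      · rw [map_zero, hm i hi]
    -- The specialization fixes the coefficients in `T`, so the `S`-algebra structure on `T` is the
    -- original one.
    have hcg : (f ≫ c) ≫ g = f := by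
      rw [Category.assoc]
      convert Category.comp_id f
      apply CommAlgCat.hom_ext
      apply AlgHom.ext
      intro t
      exact MvPolynomial.aevalTower_C _ _ t
    have hn := φ.naturality T₁ T (f ≫ c) g x
    rw [hg, hcg] at hn
    exact hn
  refine ⟨F, hF, fun m m' hm hm' hmm' => ?_⟩
  rw [key m hm, key m' hm']
  exact h T (AlgHom.id R T) _ _ hmm'

/-- A basis vector with index in `J` outside the finite set `F` has the same `F`-coordinates as `0`,
hence the same image. -/
theorem HomOver.finite_support (hV : V.InvolvesFinitelyMany) (φ : HomOver M V S)
    {T : CommAlgCat.{u} R} (f : S ⟶ T) {J : Set I} (hJ : J ∈ perp P) :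
    {i ∈ J | φ.app T f (e.basis T i) ≠ 0}.Finite := by
  classical
  obtain ⟨F, hF, h⟩ := φ.exists_finite_dependence e hV f hJ
  refine hF.subset ?_
  rintro i ⟨hi, hne⟩
  by_contra hiF
  have h0 : ∀ j, e.coord T 0 j = 0 := fun j => by rw [Equiv.coord, map_zero]; rfl
  refine hne ((h _ 0 ?_ (fun j _ => h0 j) ?_).trans (map_zero _))
  · intro j hj
    rw [e.coord_basis, Pi.single_eq_of_ne]
    rintro rfl
    exact hj hi
  · intro j hj
    rw [e.coord_basis, Pi.single_eq_of_ne, h0]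
    rintro rfl
    exact hiF hj

theorem HomOver.app_eq_finsum (hV : V.InvolvesFinitelyMany) (φ : HomOver M V S)
    {T : CommAlgCat.{u} R} (f : S ⟶ T) (m : M.obj T) :
    φ.app T f m = ∑ᶠ i, e.coord T m i • φ.app T f (e.basis T i) := by
  classical
  obtain ⟨F, hF, h⟩ := φ.exists_finite_dependence e hV f (e.coord_mem_perp T m)
  have hfin := φ.finite_support e hV f (e.coord_mem_perp T m)
  -- Two demands fix `G`: it contains `F`, so truncating `m` to `G` does not change its image, and
  -- it contains every index with a nonzero term in the sum.
  let G : Finset I := (hF.union hfin).toFinset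
  rw [finsum_eq_sum_of_support_subset (s := G)]
  · have : φ.app T f m = φ.app T f (∑ i ∈ G, e.coord T m i • e.basis T i) := by
      have hc : ∀ j, e.coord T (∑ i ∈ G, e.coord T m i • e.basis T i) j =
          if j ∈ G then e.coord T m j else 0 := by
        intro j
        simp only [e.coord_sum, e.coord_smul, e.coord_basis, Pi.single_apply, mul_ite, mul_one,
          mul_zero]
        rw [Finset.sum_ite_eq]
      refine h _ _ (fun i hi => not_not.1 hi) (fun i hi => ?_) (fun i hi => ?_)
      · rw [hc, not_not.1 hi, ite_self]
      · rw [hc, if_pos]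
        exact (Set.Finite.mem_toFinset _).2 (Or.inl hi)
    rw [this, map_sum]
    simp only [_root_.map_smul]
  · intro i hi
    have hi' : e.coord T m i • φ.app T f (e.basis T i) ≠ 0 := hi
    refine (Set.Finite.mem_toFinset _).2 (Or.inr ⟨?_, ?_⟩)
    · intro h0
      exact hi' (by rw [h0, zero_smul])
    · intro h0
      exact hi' (by rw [h0, smul_zero])

theorem Equiv.finite_support_coord_smul {n : I → V.obj S}
    (hn : ∀ J ∈ perp P, {i ∈ J | n i ≠ 0}.Finite) {T : CommAlgCat.{u} R} (f : S ⟶ T)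
    (m : M.obj T) : (Function.support fun i => e.coord T m i • V.map f (n i)).Finite := by
  refine (hn _ (e.coord_mem_perp T m)).subset fun i hi => ⟨?_, ?_⟩
  · intro h0
    exact hi (by simp only [h0, zero_smul])
  · intro h0
    exact hi (by simp only [h0, map_zero, smul_zero])

/-- The morphism `M_{|S} → V_{|S}` with given values on the basis. -/
def HomOver.ofBasis (n : I → V.obj S) (hn : ∀ J ∈ perp P, {i ∈ J | n i ≠ 0}.Finite) :
    HomOver M V S where
  app T f :=
    { toFun := fun m => ∑ᶠ i, e.coord T m i • V.map f (n i)
      map_add' := fun m m' => by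
        rw [← finsum_add_distrib (e.finite_support_coord_smul hn f m)
          (e.finite_support_coord_smul hn f m')]
        simp only [e.coord_add, add_smul]
      map_smul' := fun t m => by
        rw [RingHom.id_apply, smul_finsum' _ (e.finite_support_coord_smul hn f m)]
        simp only [e.coord_smul, mul_smul] }
  naturality T T' f g m := by
    change ∑ᶠ i, e.coord T' (M.map g m) i • V.map (f ≫ g) (n i) =
      V.map g (∑ᶠ i, e.coord T m i • V.map f (n i))
    rw [AddMonoidHom.map_finsum _ (e.finite_support_coord_smul hn f m)]
    simp only [e.coord_map, V.map_smul, V.map_comp]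

theorem HomOver.ofBasis_app (n : I → V.obj S) (hn : ∀ J ∈ perp P, {i ∈ J | n i ≠ 0}.Finite)
    {T : CommAlgCat.{u} R} (f : S ⟶ T) (m : M.obj T) :
    (HomOver.ofBasis e n hn).app T f m = ∑ᶠ i, e.coord T m i • V.map f (n i) := rfl

theorem HomOver.ofBasis_app_basis (n : I → V.obj S)
    (hn : ∀ J ∈ perp P, {i ∈ J | n i ≠ 0}.Finite)
    {T : CommAlgCat.{u} R} (f : S ⟶ T) (i : I) :
    (HomOver.ofBasis e n hn).app T f (e.basis T i) = V.map f (n i) := by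
  classical
  rw [HomOver.ofBasis_app, finsum_eq_single _ i]
  · rw [e.coord_basis, Pi.single_eq_same, one_smul]
  · intro j hj
    rw [e.coord_basis, Pi.single_eq_of_ne hj, zero_smul]

/-- A morphism out of an essentially free functor is determined by its values on the basis. -/
theorem HomOver.app_eq_of_basis (hV : V.InvolvesFinitelyMany) (φ ψ : HomOver M V S)
    (h : ∀ i, φ.app S (𝟙 S) (e.basis S i) = ψ.app S (𝟙 S) (e.basis S i))
    {T : CommAlgCat.{u} R} (f : S ⟶ T) (m : M.obj T) : φ.app T f m = ψ.app T f m := by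
  have hb : ∀ (χ : HomOver M V S) (i : I),
      χ.app T f (e.basis T i) = V.map f (χ.app S (𝟙 S) (e.basis S i)) := by
    intro χ i
    have := χ.naturality S T (𝟙 S) f (e.basis S i)
    rw [e.map_basis, Category.id_comp] at this
    exact this
  rw [φ.app_eq_finsum e hV, ψ.app_eq_finsum e hV]
  simp only [hb, h]

end Expansion

end ModFunctor

/-! ### Duals of essentially free functors and reflexivity -/

namespace ModFunctor

section Reflexivity

variable {R : Type u} [CommRing R] {M : ModFunctor.{u + 1} R} {I : Type u} {P : Set (Set I)}

/-- An element of `M^*(S)` as a morphism `M_{|S} → 𝓡_{|S}`. -/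
def dualHomOver {S : CommAlgCat.{u} R} (φ : M.dual.obj S) : HomOver M (structureFunctor R) S where
  app := φ.1
  naturality := φ.2

/-- The dual of `⋂_{α ∈ P} (⨁_α 𝓡 × ∏_{I - α} 𝓡)` is the functor of the same kind defined by
`perp P`. -/
def Equiv.dual (e : M.Equiv (interFree I P)) : M.dual.Equiv (interFree I (perp P)) where
  app S :=
    { toFun := fun φ => ⟨fun i => φ.1 S (𝟙 S) (e.basis S i), fun _ hJ =>
        (dualHomOver φ).finite_support e involvesFinitelyMany_structureFunctor (𝟙 S) hJ⟩
      map_add' := fun _ _ => rfl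
      map_smul' := fun _ _ => rfl
      invFun := fun n => ⟨(HomOver.ofBasis e (V := structureFunctor R) n.1 n.2).app,
        (HomOver.ofBasis e (V := structureFunctor R) n.1 n.2).naturality⟩
      left_inv := fun φ => by
        apply Subtype.ext
        funext T f
        apply LinearMap.ext
        intro m
        let n : I → (structureFunctor R).obj S := fun i => φ.1 S (𝟙 S) (e.basis S i)
        have hn : ∀ J ∈ perp P, {i ∈ J | n i ≠ 0}.Finite := fun J hJ =>
          (dualHomOver φ).finite_support e involvesFinitelyMany_structureFunctor (𝟙 S) hJ
        refine HomOver.app_eq_of_basis e involvesFinitelyMany_structureFunctor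
          (HomOver.ofBasis e n hn) (dualHomOver φ) (fun i => ?_) f m
        exact HomOver.ofBasis_app_basis e n hn (𝟙 S) i
      right_inv := fun n => by
        apply Subtype.ext
        funext i
        exact HomOver.ofBasis_app_basis e (V := structureFunctor R) n.1 n.2 (𝟙 S) i }
  naturality {S T} f φ := by
    apply Subtype.ext
    funext i
    change φ.1 T (f ≫ 𝟙 T) (e.basis T i) = f.hom (φ.1 S (𝟙 S) (e.basis S i))
    have h := φ.2 S T (𝟙 S) f (e.basis S i)
    rw [e.map_basis] at h
    rw [← h, Category.comp_id, Category.id_comp]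

theorem Equiv.dual_coord (e : M.Equiv (interFree I P)) (S : CommAlgCat.{u} R) (φ : M.dual.obj S)
    (i : I) : e.dual.coord S φ i = φ.1 S (𝟙 S) (e.basis S i) := rfl

theorem Equiv.dual_basis_apply (e : M.Equiv (interFree I P)) (S : CommAlgCat.{u} R) (i : I)
    (m : M.obj S) : (e.dual.basis S i).1 S (𝟙 S) m = e.coord S m i := by
  classical
  have h := (dualHomOver (e.dual.basis S i)).app_eq_finsum e
    involvesFinitelyMany_structureFunctor (𝟙 S) m
  refine h.trans ?_
  have hb : ∀ j, (dualHomOver (e.dual.basis S i)).app S (𝟙 S) (e.basis S j) =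
      (Pi.single i 1 : I → S) j := fun j =>
    (e.dual_coord S _ j).symm.trans (e.dual.coord_basis S i j)
  rw [finsum_eq_single _ i]
  · rw [hb, Pi.single_eq_same]
    exact mul_one (e.coord S m i)
  · intro j hj
    rw [hb, Pi.single_eq_of_ne hj]
    exact mul_zero (e.coord S m j)

/-- Dualizing replaces `P` by `perp P`, and the map to the bidual preserves coordinates. For
surjectivity, the finiteness conditions imposed by `perp (perp P)` include those imposed by `P`. -/
theorem IsEssentiallyFree.isReflexive (hM : M.IsEssentiallyFree) : M.IsReflexive := by
  obtain ⟨I, P, ⟨e⟩⟩ := hM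
  intro S
  have key : ∀ (m : M.obj S) (i : I), e.dual.dual.coord S (M.toBidual S m) i = e.coord S m i := by
    intro m i
    rw [Equiv.dual_coord]
    change (e.dual.basis S i).1 S (𝟙 S) (M.map (𝟙 S) m) = _
    rw [M.map_id, e.dual_basis_apply]
  constructor
  · intro m m' h
    apply e.coord_ext
    intro i
    rw [← key, ← key, h]
  · intro Φ
    let x : (interFree I P : ModFunctor R).obj S :=
      ⟨(e.dual.dual.app S Φ).1, fun α hα => (e.dual.dual.app S Φ).2 α (subset_perp_perp P hα)⟩
    refine ⟨(e.app S).symm x, e.dual.dual.coord_ext S fun i => ?_⟩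
    rw [key, Equiv.coord, LinearEquiv.apply_symm_apply]
    rfl

theorem IsEssentiallyFree.of_isIso {A B : AlgFunctor R} (φ : A ⟶ B) [IsIso φ]
    (h : A.toModFunctor.IsEssentiallyFree) : B.toModFunctor.IsEssentiallyFree := by
  obtain ⟨I, P, ⟨e⟩⟩ := h
  let f : ∀ S : CommAlgCat.{u} R, A.obj S ≃ₐ[S] B.obj S := fun S =>
    AlgEquiv.ofBijective _ (AlgFunctor.bijective_of_isIso φ S)
  refine ⟨I, P, ⟨⟨fun S => (f S).symm.toLinearEquiv.trans (e.app S), fun {S T} g b => ?_⟩⟩⟩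
  obtain ⟨a, rfl⟩ := (f S).surjective b
  have h1 : B.map g (f S a) = f T (A.map g a) := (AlgFunctor.Hom.naturality φ g a).symm
  change e.app T ((f T).symm (B.map g (f S a))) =
    (interFree I P : ModFunctor R).map g (e.app S ((f S).symm (f S a)))
  rw [h1, AlgEquiv.symm_apply_apply, AlgEquiv.symm_apply_apply]
  exact e.naturality g a

end Reflexivity

end ModFunctor

/-! ### Factorization of morphisms `A → 𝓑` through the image over `R` -/

section Factorization

variable {R : Type u} [CommRing R] {A : AlgFunctor R}

open ModFunctor

/-- A morphism of functors of algebras as a morphism of functors of modules. -/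
def AlgFunctor.Hom.toHomOver {A B : AlgFunctor R} (φ : A ⟶ B) (S : CommAlgCat.{u} R) :
    HomOver A.toModFunctor B.toModFunctor S where
  app T _ := (AlgFunctor.Hom.app φ T).toLinearMap
  naturality _ _ _ g m := AlgFunctor.Hom.naturality φ g m

/-- The basis is already defined over `R`, and a morphism is determined by its values there. -/
theorem AlgFunctor.hom_ext_base (hA : A.toModFunctor.IsEssentiallyFree) {B : CommAlgCat.{u} R}
    {φ ψ : A ⟶ (quasiCoherent R).obj B} (h : ∀ a, baseValue φ a = baseValue ψ a) : φ = ψ := by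
  obtain ⟨I, P, ⟨e⟩⟩ := hA
  apply AlgFunctor.hom_ext_apply
  intro T a
  refine HomOver.app_eq_of_basis e (involvesFinitelyMany_quasiCoherent B)
    (AlgFunctor.Hom.toHomOver φ (CommAlgCat.of R R))
    (AlgFunctor.Hom.toHomOver ψ (CommAlgCat.of R R)) (fun i => ?_) (baseHom T) a
  exact (app_base φ _).trans ((congrArg _ (congrArg _ (h _))).trans (app_base ψ _).symm)

/-- Over `R` the map is `h` itself. Over a general `T` injectivity can be lost by tensoring, which
is why the factorization below tests its algebra identities over `R`. -/
theorem quasiCoherent_map_app_base_injective {B C : CommAlgCat.{u} R} (h : B ⟶ C)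
    (hh : Function.Injective h.hom) :
    Function.Injective (AlgFunctor.Hom.app ((quasiCoherent R).map h) (CommAlgCat.of R R)) := by
  have hB : ∀ y, ∃ b : B, y = qcEquiv B (CommAlgCat.of R R) ((1 : R) ⊗ₜ[R] b) := fun y =>
    ⟨baseValue (𝟙 ((quasiCoherent R).obj B)) y, app_base (𝟙 ((quasiCoherent R).obj B)) y⟩
  intro y y' hy
  obtain ⟨b, rfl⟩ := hB y
  obtain ⟨b', rfl⟩ := hB y'
  rw [quasiCoherent_map_app_qcEquiv, quasiCoherent_map_app_qcEquiv] at hy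
  have h1 : (1 : R) ⊗ₜ[R] h.hom b = (1 : R) ⊗ₜ[R] h.hom b' :=
    (qcEquiv C (CommAlgCat.of R R)).injective hy
  have h2 := congrArg (Algebra.TensorProduct.lid R C) h1
  rw [Algebra.TensorProduct.lid_tmul, Algebra.TensorProduct.lid_tmul, one_smul, one_smul] at h2
  rw [hh h2]

section Multiplicativity

variable {I : Type u} {P : Set (Set I)} {V : AlgFunctor R}

/-- The basis of an essentially free functor of algebras. -/
def algBasis (e : A.toModFunctor.Equiv (interFree I P)) (S : CommAlgCat.{u} R) (i : I) : A.obj S :=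
  e.basis S i

theorem map_algBasis (e : A.toModFunctor.Equiv (interFree I P)) {S T : CommAlgCat.{u} R}
    (f : S ⟶ T) (i : I) : A.map f (algBasis e S i) = algBasis e T i :=
  e.map_basis f i

/-- Both `b ↦ φ(ab)` and `b ↦ v φ(b)` are linear morphisms over `S`, so agreement on the basis
suffices. -/
theorem map_mul_right_of_basis (e : A.toModFunctor.Equiv (interFree I P))
    (hV : V.toModFunctor.InvolvesFinitelyMany)
    (φ : ∀ T : CommAlgCat.{u} R, A.obj T →ₗ[T] V.obj T)
    (hφ : ∀ {T U : CommAlgCat.{u} R} (g : T ⟶ U) (a : A.obj T), φ U (A.map g a) = V.map g (φ T a))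
    {S : CommAlgCat.{u} R} (a : A.obj S) (v : V.obj S)
    (h : ∀ i, φ S (a * algBasis e S i) = v * φ S (algBasis e S i))
    {T : CommAlgCat.{u} R} (f : S ⟶ T) (b : A.obj T) :
    φ T (A.map f a * b) = V.map f v * φ T b := by
  let μ : HomOver A.toModFunctor V.toModFunctor S :=
    { app := fun T f => (φ T).comp (LinearMap.mulLeft T (A.map f a))
      naturality := fun T U f g (b : A.obj T) => by
        change φ U (A.map (f ≫ g) a * A.map g b) = V.map g (φ T (A.map f a * b))
        rw [A.map_comp, ← map_mul, hφ] }
  let ν : HomOver A.toModFunctor V.toModFunctor S :=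
    { app := fun T f => (LinearMap.mulLeft T (V.map f v)).comp (φ T)
      naturality := fun T U f g (b : A.obj T) => by
        change V.map (f ≫ g) v * φ U (A.map g b) = V.map g (V.map f v * φ T b)
        rw [V.map_comp, map_mul, hφ] }
  refine HomOver.app_eq_of_basis e hV μ ν (fun i => ?_) f b
  change φ S (A.map (𝟙 S) a * algBasis e S i) = V.map (𝟙 S) v * φ S (algBasis e S i)
  rw [A.map_id, V.map_id]
  exact h i

/-- A linear morphism out of an essentially free functor of algebras is multiplicative if it is so
over `R`. -/
theorem map_mul_of_base (e : A.toModFunctor.Equiv (interFree I P))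
    (hV : V.toModFunctor.InvolvesFinitelyMany)
    (φ : ∀ T : CommAlgCat.{u} R, A.obj T →ₗ[T] V.obj T)
    (hφ : ∀ {T U : CommAlgCat.{u} R} (g : T ⟶ U) (a : A.obj T), φ U (A.map g a) = V.map g (φ T a))
    (h : ∀ a b : A.obj (CommAlgCat.of R R), φ _ (a * b) = φ _ a * φ _ b)
    (T : CommAlgCat.{u} R) (a b : A.obj T) : φ T (a * b) = φ T a * φ T b := by
  -- The basis argument is used once per factor. Here the fixed factor is a basis vector coming from
  -- `R`; commutativity then puts it on the right for the second use, with `a` fixed.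
  have hstep : ∀ i, φ T (a * algBasis e T i) = φ T a * φ T (algBasis e T i) := fun i => by
    have := map_mul_right_of_basis e hV φ hφ (algBasis e (CommAlgCat.of R R) i)
      (φ _ (algBasis e (CommAlgCat.of R R) i)) (fun j => h _ _) (baseHom T) a
    rw [map_algBasis, ← hφ, map_algBasis] at this
    rw [mul_comm a, this, mul_comm]
  have := map_mul_right_of_basis e hV φ hφ a (φ T a) hstep (𝟙 T) b
  rwa [A.map_id, V.map_id] at this

end Multiplicativity

/-- A morphism from an essentially free functor of algebras to a quasi-coherent algebra `𝓑` factors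
through the quasi-coherent algebra of the image of `A(R) → B`. -/
theorem exists_factorization_range (hA : A.toModFunctor.IsEssentiallyFree) {B : CommAlgCat.{u} R}
    (φ : A ⟶ (quasiCoherent R).obj B) :
    ∃ ψ : A ⟶ (quasiCoherent R).obj (CommAlgCat.of R (baseValue φ).range),
      ψ ≫ (quasiCoherent R).map (CommAlgCat.ofHom (baseValue φ).range.val) = φ := by
  obtain ⟨I, P, ⟨e⟩⟩ := hA
  let R₀ : CommAlgCat.{u} R := CommAlgCat.of R R
  let C : CommAlgCat.{u} R := CommAlgCat.of R (baseValue φ).range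
  let ι : C ⟶ B := CommAlgCat.ofHom (baseValue φ).range.val
  have hιinj := quasiCoherent_map_app_base_injective ι Subtype.val_injective
  -- The factorization is first built as a linear morphism, by prescribing the forced values on the
  -- basis. Finiteness is inherited from `φ`, as `n i` vanishes whenever the value of `φ` on the
  -- basis vector does.
  let n : I → ((quasiCoherent R).obj C).toModFunctor.obj R₀ := fun i =>
    qcEquiv C R₀ ((1 : R) ⊗ₜ[R] (baseValue φ).rangeRestrict (e.basis R₀ i))
  have hn : ∀ J ∈ perp P, {i ∈ J | n i ≠ 0}.Finite := by
    intro J hJ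
    refine ((AlgFunctor.Hom.toHomOver φ R₀).finite_support e
      (involvesFinitelyMany_quasiCoherent B) (𝟙 R₀) hJ).subset ?_
    rintro i ⟨hi, hne⟩
    refine ⟨hi, fun h0 => hne ?_⟩
    have h0' : AlgFunctor.Hom.app φ R₀ (e.basis R₀ i) = 0 := h0
    have h1 : baseValue φ (e.basis R₀ i) = 0 := by
      change Algebra.TensorProduct.lid R B ((qcEquiv B R₀).symm
        (AlgFunctor.Hom.app φ R₀ (e.basis R₀ i))) = 0
      rw [h0', map_zero, map_zero]
    have h2 : (baseValue φ).rangeRestrict (e.basis R₀ i) = 0 := Subtype.ext h1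
    change qcEquiv C R₀ ((1 : R) ⊗ₜ[R] (baseValue φ).rangeRestrict (e.basis R₀ i)) = 0
    rw [h2, TensorProduct.tmul_zero, map_zero]
  let χ : HomOver A.toModFunctor ((quasiCoherent R).obj C).toModFunctor R₀ :=
    HomOver.ofBasis e n hn
  let χι : HomOver A.toModFunctor ((quasiCoherent R).obj B).toModFunctor R₀ :=
    { app := fun T f => (AlgFunctor.Hom.app ((quasiCoherent R).map ι) T).toLinearMap.comp
        (χ.app T f)
      naturality := fun T T' f g m => by
        refine Eq.trans ?_ (AlgFunctor.Hom.naturality ((quasiCoherent R).map ι) g (χ.app T f m))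
        exact congrArg (AlgFunctor.Hom.app ((quasiCoherent R).map ι) T')
          (χ.naturality T T' f g m) }
  have hχ : ∀ (T : CommAlgCat.{u} R) (a : A.obj T),
      AlgFunctor.Hom.app ((quasiCoherent R).map ι) T (χ.app T (baseHom T) a) =
        AlgFunctor.Hom.app φ T a := by
    intro T a
    refine HomOver.app_eq_of_basis e (involvesFinitelyMany_quasiCoherent B) χι
      (AlgFunctor.Hom.toHomOver φ R₀) (fun i => ?_) (baseHom T) a
    change AlgFunctor.Hom.app ((quasiCoherent R).map ι) R₀ (χ.app R₀ (𝟙 R₀) (e.basis R₀ i)) =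
      AlgFunctor.Hom.app φ R₀ (e.basis R₀ i)
    refine (congrArg _ (HomOver.ofBasis_app_basis e n hn (𝟙 R₀) i)).trans ?_
    rw [ModFunctor.map_id]
    refine ((quasiCoherent_map_app_qcEquiv ι R₀ _).trans
      (congrArg _ (Algebra.TensorProduct.map_tmul _ _ _ _))).trans ?_
    exact (app_base φ (e.basis R₀ i)).symm
  let ρ : ∀ T : CommAlgCat.{u} R, A.obj T →ₗ[T] ((quasiCoherent R).obj C).obj T :=
    fun T => χ.app T (baseHom T)
  have hρ : ∀ {T U : CommAlgCat.{u} R} (g : T ⟶ U) (a : A.obj T),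
      ρ U (A.map g a) = ((quasiCoherent R).obj C).map g (ρ T a) := by
    intro T U g a
    have h := χ.naturality T U (baseHom T) g a
    rw [baseHom_comp] at h
    exact h
  have hρι : ∀ (T : CommAlgCat.{u} R) (a : A.obj T),
      AlgFunctor.Hom.app ((quasiCoherent R).map ι) T (ρ T a) = AlgFunctor.Hom.app φ T a := hχ
  have hmul : ∀ (T : CommAlgCat.{u} R) (a b : A.obj T), ρ T (a * b) = ρ T a * ρ T b := by
    -- Over `R` the inclusion into `B` is injective and the composite `φ` is multiplicative.
    refine map_mul_of_base e (involvesFinitelyMany_quasiCoherent C) ρ hρ fun a b => hιinj ?_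
    rw [hρι, map_mul, map_mul, hρι, hρι]
  have hone : ∀ T : CommAlgCat.{u} R, ρ T 1 = 1 := by
    intro T
    have hone₀ : ρ (CommAlgCat.of R R) 1 = 1 := by
      apply hιinj
      rw [hρι, map_one, map_one]
    rw [← map_one (A.map (baseHom T)), hρ, hone₀, map_one]
  let ψ : AlgFunctor.Hom A ((quasiCoherent R).obj C) :=
    { app := fun T => AlgHom.ofLinearMap (ρ T) (hone T) (hmul T)
      naturality := hρ }
  exact ⟨ψ, AlgFunctor.hom_ext_apply hρι⟩

end Factorization

/-! ### `Spec A` as a direct limit -/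

section SpecColimit

variable {R : Type u} [CommRing R] {A : AlgFunctor R}

/-- The quotient of `A` given by a morphism surjective over `R`. -/
def quotientMk {B : CommAlgCat.{u} R} (φ : A ⟶ (quasiCoherent R).obj B)
    (h : Function.Surjective (baseValue φ)) : (isQuotient A).FullSubcategory :=
  ⟨StructuredArrow.mk φ, fun S => app_surjective_of_baseValue φ h S⟩

/-- Every point of `Spec A` comes from a quasi-coherent quotient, to which all its other
factorizations through such quotients map. -/
theorem exists_quotient_factorization (hA : A.toModFunctor.IsEssentiallyFree)
    {S : CommAlgCat.{u} R} (x : A ⟶ (quasiCoherent R).obj S) :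
    ∃ (Q : (isQuotient A).FullSubcategory) (k : Q.obj.right ⟶ S),
      Q.obj.hom ≫ (quasiCoherent R).map k = x ∧
      ∀ (q : (isQuotient A).FullSubcategory) (f : (quotientDiagram A).obj q ⟶
        (quasiCoherent R).obj S), q.obj.hom ≫ f = x →
          ∃ p : q ⟶ Q, (quotientDiagram A).map p ≫ (quasiCoherent R).map k = f := by
  obtain ⟨ψ, hψ⟩ := exists_factorization_range hA x
  have hψval : ∀ a, (baseValue ψ a : S) = baseValue x a := fun a => by
    rw [← congrArg (fun y => baseValue y a) hψ]
    exact (baseValue_comp_map ψ (CommAlgCat.ofHom (baseValue x).range.val) a).symm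
  have hsurj : Function.Surjective (baseValue ψ) := by
    rintro ⟨_, a, rfl⟩
    exact ⟨a, Subtype.ext (hψval a)⟩
  refine ⟨quotientMk ψ hsurj, CommAlgCat.ofHom (baseValue x).range.val, hψ, fun q f hf => ?_⟩
  let h : q.obj.right ⟶ S := quasiCoherentPreimage f
  have hh : (quasiCoherent R).map h = f := map_quasiCoherentPreimage f
  have hval : ∀ a, h.hom (baseValue q.obj.hom a) = baseValue x a := fun a => by
    rw [← baseValue_comp_map, hh]
    exact congrArg (fun y => baseValue y a) hf
  -- As `A(R)` surjects onto the algebra of `q`, the image of `h` lies in that of `A(R) → S`, so `h`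
  -- corestricts.
  let p₀ : q.obj.right ⟶ CommAlgCat.of R (baseValue x).range :=
    CommAlgCat.ofHom (h.hom.codRestrict _ fun b => by
      obtain ⟨a, rfl⟩ := baseValue_surjective q.obj.hom (q.property _) b
      exact ⟨a, (hval a).symm⟩)
  have hp₀ : q.obj.hom ≫ (quasiCoherent R).map p₀ = ψ := by
    refine AlgFunctor.hom_ext_base hA fun a => ?_
    refine (baseValue_comp_map q.obj.hom p₀ a).trans (Subtype.ext ?_)
    exact (hval a).trans (hψval a).symm
  refine ⟨ObjectProperty.homMk (StructuredArrow.homMk p₀ hp₀), ?_⟩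
  refine ((quasiCoherent R).map_comp p₀ _).symm.trans (Eq.trans ?_ hh)
  congr 1

theorem setFunctor_hom_app_map {X Y : SetFunctor R} (t : X ⟶ Y) {S S' : CommAlgCat.{u} R}
    (g : S ⟶ S') (x : X.obj S) : t.app S' (X.map g x) = Y.map g (t.app S x) :=
  NatTrans.naturality_apply t g x

theorem spec_hom_app_comp_map {B : AlgFunctor R} {Y : SetFunctor R}
    (t : (specFunctor R).obj (op B) ⟶ Y) {S S' : CommAlgCat.{u} R}
    (f : B ⟶ (quasiCoherent R).obj S) (g : S ⟶ S') :
    t.app S' (f ≫ (quasiCoherent R).map g) = Y.map g (t.app S f) :=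
  setFunctor_hom_app_map t g f

/-- `Spec A` is the direct limit of the spectra of the quasi-coherent quotients of `A`. -/
def isColimitSpecQuotientCone (hA : A.toModFunctor.IsEssentiallyFree) :
    IsColimit ((specFunctor R).mapCocone (quotientCone A).op) := by
  choose Q k hk huniv using
    fun (S : CommAlgCat.{u} R) (x : A ⟶ (quasiCoherent R).obj S) =>
      exists_quotient_factorization hA x
  let d (s : Cocone ((quotientDiagram A).op ⋙ specFunctor R)) (S : CommAlgCat.{u} R)
      (x : A ⟶ (quasiCoherent R).obj S) : s.pt.obj S :=
    (s.ι.app (op (Q S x))).app S ((quasiCoherent R).map (k S x))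
  -- The chosen factorization does not matter: any other one maps to it, and the cocone is
  -- compatible with that map.
  have hd : ∀ (s : Cocone ((quotientDiagram A).op ⋙ specFunctor R)) (S : CommAlgCat.{u} R)
      (q : (isQuotient A).FullSubcategory)
      (f : (quotientDiagram A).obj q ⟶ (quasiCoherent R).obj S),
      d s S (q.obj.hom ≫ f) = (s.ι.app (op q)).app S f := by
    intro s S q f
    obtain ⟨p, hp⟩ := huniv S (q.obj.hom ≫ f) q f rfl
    have hw := s.w p.op
    have := congrArg (fun t => t.app S ((quasiCoherent R).map (k S (q.obj.hom ≫ f)))) hw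
    refine this.symm.trans ?_
    exact congrArg ((s.ι.app (op q)).app S) hp
  refine
    { desc := fun s =>
        { app := fun S => TypeCat.ofHom (d s S)
          naturality := fun S S' g => ?_ }
      fac := fun s q => ?_
      uniq := fun s m hm => ?_ }
  · ext (x : A ⟶ (quasiCoherent R).obj S)
    change d s S' (x ≫ (quasiCoherent R).map g) = s.pt.map g (d s S x)
    have h1 : x ≫ (quasiCoherent R).map g =
        (Q S x).obj.hom ≫ ((quasiCoherent R).map (k S x) ≫ (quasiCoherent R).map g) := by
      rw [← Category.assoc]
      exact congrArg (fun y => y ≫ (quasiCoherent R).map g) (hk S x).symm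
    rw [h1]
    refine (hd s S' (Q S x) _).trans ?_
    exact spec_hom_app_comp_map (s.ι.app (op (Q S x))) ((quasiCoherent R).map (k S x)) g
  · ext S f
    exact hd s S q.unop f
  · ext S x
    change m.app S x = d s S x
    have := congrArg (fun t => t.app S ((quasiCoherent R).map (k S x))) (hm (op (Q S x)))
    refine Eq.trans ?_ this
    exact congrArg (m.app S) (hk S x).symm

end SpecColimit

/-! ### `𝔸_{Spec A}` as an inverse limit -/

section FunctionsLimit

variable {R : Type u} [CommRing R]

/-- `𝓐_i = 𝔸_{Spec 𝓐_i}` for the quasi-coherent quotients of `A`. -/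
def quotientDiagramIso (A : AlgFunctor R) :
    quotientDiagram A ≅ quotientDiagram A ⋙ (specFunctor R).rightOp ⋙ functionsFunctor R :=
  NatIso.ofComponents
    (fun q => @asIso _ _ _ _ (toFunctionsSpec ((quotientDiagram A).obj q))
      (isIso_toFunctionsSpec_quasiCoherent q.obj.right))
    (fun p => toFunctionsSpec_naturality ((quotientDiagram A).map p))

theorem quotientDiagramIso_hom_app (A : AlgFunctor R) (q : (isQuotient A).FullSubcategory) :
    (quotientDiagramIso A).hom.app q = toFunctionsSpec ((quotientDiagram A).obj q) := rfl

/-- The cone `𝔸_{Spec A} → 𝔸_{Spec 𝓐_i} = 𝓐_i`. -/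
abbrev functionsSpecCone (A : AlgFunctor R) : Cone (quotientDiagram A) :=
  (Cone.postcompose (quotientDiagramIso A).inv).obj
    (((specFunctor R).rightOp ⋙ functionsFunctor R).mapCone (quotientCone A))

/-- Clears the inverse of `𝓐_i ≅ 𝔸_{Spec 𝓐_i}`, giving equations in the form handled by
transposition. -/
theorem comp_functionsSpecCone_π_eq_iff {A C : AlgFunctor R}
    (q : (isQuotient A).FullSubcategory)
    (m : C ⟶ (functionsFunctor R).obj (op ((specFunctor R).obj (op A))))
    (n : C ⟶ (quotientDiagram A).obj q) :
    m ≫ (functionsSpecCone A).π.app q = n ↔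
      m ≫ (functionsFunctor R).map ((specFunctor R).map ((quotientCone A).π.app q).op).op =
        n ≫ toFunctionsSpec ((quotientDiagram A).obj q) := by
  have h := Iso.comp_inv_eq (f := m ≫ (functionsFunctor R).map
    ((specFunctor R).map ((quotientCone A).π.app q).op).op) (g := n)
    ((quotientDiagramIso A).app q)
  rw [Category.assoc] at h
  exact h

theorem toFunctionsSpec_comp_functionsSpecCone (A : AlgFunctor R)
    (q : (isQuotient A).FullSubcategory) :
    toFunctionsSpec A ≫ (functionsSpecCone A).π.app q = q.obj.hom :=
  (comp_functionsSpecCone_π_eq_iff q (toFunctionsSpec A) q.obj.hom).2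
    (toFunctionsSpec_naturality q.obj.hom).symm

/-- `𝔸_{Spec A}` is the inverse limit of the quasi-coherent quotients of `A`. -/
def isLimitFunctionsSpecCone {A : AlgFunctor R}
    (hc : IsColimit ((specFunctor R).mapCocone (quotientCone A).op)) :
    IsLimit (functionsSpecCone A) where
  -- Applying `Spec` to the cone gives a cocone on the `Spec 𝓐_i`; the lift is the transpose of the
  -- induced morphism `Spec A → Spec C`, with `C` the vertex of the cone.
  lift s := toFunctionsOfSpec (hc.desc ((specFunctor R).mapCocone s.op))
  fac s q := (comp_functionsSpecCone_π_eq_iff q _ (s.π.app q)).2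
    (toFunctionsOfSpec_comp_map _ _ _ (hc.fac ((specFunctor R).mapCocone s.op) (op q)))
  uniq s m hm := by
    have h : toSpecOfFunctions m = hc.desc ((specFunctor R).mapCocone s.op) :=
      hc.uniq ((specFunctor R).mapCocone s.op) _ fun q =>
        spec_map_comp_toSpecOfFunctions _ _ m
          ((comp_functionsSpecCone_π_eq_iff q.unop m (s.π.app q.unop)).1 (hm q.unop))
    rw [← h]
    exact (toFunctionsOfSpec_toSpecOfFunctions m).symm

end FunctionsLimit

/-! ### Pro-quasicoherence, affineness and the anti-equivalence -/

section Duality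

variable {R : Type u} [CommRing R]

/-- `A` and `𝔸_{Spec A}` are then limits of the same diagram, and the canonical morphism is
compatible with the projections. -/
theorem isIso_toFunctionsSpec_of_isProQuasicoherent {A : AlgFunctor R}
    (hA : A.toModFunctor.IsEssentiallyFree) (hp : IsProQuasicoherent A) :
    IsIso (toFunctionsSpec A) := by
  obtain ⟨hp⟩ := hp
  let f : quotientCone A ⟶ functionsSpecCone A :=
    { hom := toFunctionsSpec A
      w := fun q => toFunctionsSpec_comp_functionsSpecCone A q }
  have := IsLimit.hom_isIso hp (isLimitFunctionsSpecCone (isColimitSpecQuotientCone hA)) f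
  exact inferInstanceAs (IsIso ((Cone.forget _).map f))

theorem isProQuasicoherent_of_isIso_toFunctionsSpec {A : AlgFunctor R}
    (hA : A.toModFunctor.IsEssentiallyFree) (h : IsIso (toFunctionsSpec A)) :
    IsProQuasicoherent A := by
  let hL := isLimitFunctionsSpecCone (isColimitSpecQuotientCone hA)
  have hlift : hL.lift (quotientCone A) = toFunctionsSpec A :=
    (hL.uniq (quotientCone A) (toFunctionsSpec A)
      fun q => toFunctionsSpec_comp_functionsSpecCone A q).symm
  have : IsIso (hL.lift (quotientCone A)) := hlift ▸ h
  exact ⟨hL.ofPointIso⟩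

/-- By the triangle identity, a one-sided inverse of this morphism is `Spec` of an isomorphism. The
next lemma is the mirror image. -/
theorem isIso_toSpecFunctions_spec {A : AlgFunctor R} [IsIso (toFunctionsSpec A)] :
    IsIso (toSpecFunctions ((specFunctor R).obj (op A))) :=
  IsIso.of_isIso_fac_right (toSpecFunctions_comp_spec_toFunctionsSpec A)

theorem isIso_toFunctionsSpec_functions {X : SetFunctor R} [IsIso (toSpecFunctions X)] :
    IsIso (toFunctionsSpec ((functionsFunctor R).obj (op X))) :=
  IsIso.of_isIso_fac_right (toFunctionsSpec_comp_functions_toSpecFunctions X)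

theorem affineFree_spec {A : AlgFunctor R} (hA : proQuasicoherentFree R A) :
    affineFree R ((specFunctor R).obj (op A)) := by
  have := isIso_toFunctionsSpec_of_isProQuasicoherent hA.2 hA.1
  have hfree := ModFunctor.IsEssentiallyFree.of_isIso (toFunctionsSpec A) hA.2
  exact ⟨⟨isIso_toSpecFunctions_spec, hfree.isReflexive⟩, hfree⟩

theorem proQuasicoherentFree_functions {X : SetFunctor R} (hX : affineFree R X) :
    proQuasicoherentFree R ((functionsFunctor R).obj (op X)) := by
  have := hX.1.1
  exact ⟨isProQuasicoherent_of_isIso_toFunctionsSpec hX.2 isIso_toFunctionsSpec_functions, hX.2⟩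

/-- If `Spec A` is affine, then morphisms from `𝔸_{Spec A}` to quasi-coherent algebras are
determined by their restriction to `A`. -/
theorem hom_ext_of_toFunctionsSpec_comp {A : AlgFunctor R}
    [IsIso (toSpecFunctions ((specFunctor R).obj (op A)))] {B : CommAlgCat.{u} R}
    {φ ψ : (functionsFunctor R).obj (op ((specFunctor R).obj (op A))) ⟶ (quasiCoherent R).obj B}
    (h : toFunctionsSpec A ≫ φ = toFunctionsSpec A ≫ ψ) : φ = ψ := by
  -- Injectivity of this map on `B`-points is exactly the claim.
  have hiso : IsIso ((specFunctor R).map (toFunctionsSpec A).op) :=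
    IsIso.of_isIso_fac_left (toSpecFunctions_comp_spec_toFunctionsSpec A)
  have hB : IsIso (((specFunctor R).map (toFunctionsSpec A).op).app B) := inferInstance
  exact ((isIso_iff_bijective _).1 hB).1 h

/-- A cofinality argument: `𝔸_{Spec A}` is the limit of the quotients of `A`, each of which extends
to a quotient of `𝔸_{Spec A}`, and every quotient of the latter receives a morphism from such an
extension. -/
theorem isProQuasicoherent_functions_spec {A : AlgFunctor R}
    (hA : A.toModFunctor.IsEssentiallyFree)
    (h : IsIso (toSpecFunctions ((specFunctor R).obj (op A)))) :
    IsProQuasicoherent ((functionsFunctor R).obj (op ((specFunctor R).obj (op A)))) := by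
  let hL := isLimitFunctionsSpecCone (isColimitSpecQuotientCone hA)
  let B : AlgFunctor R := (functionsFunctor R).obj (op ((specFunctor R).obj (op A)))
  let η : A ⟶ B := toFunctionsSpec A
  let π (q : (isQuotient A).FullSubcategory) : B ⟶ (quasiCoherent R).obj q.obj.right :=
    (functionsSpecCone A).π.app q
  have hπ : ∀ q, η ≫ π q = q.obj.hom := toFunctionsSpec_comp_functionsSpecCone A
  let ext (q : (isQuotient A).FullSubcategory) : (isQuotient B).FullSubcategory :=
    ⟨StructuredArrow.mk (π q), fun S y => by
      obtain ⟨a, ha⟩ := q.property S y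
      refine ⟨AlgFunctor.Hom.app η S a, ?_⟩
      rw [← hπ q] at ha
      exact ha⟩
  let extMap {q q' : (isQuotient A).FullSubcategory} (p : q ⟶ q') : ext q ⟶ ext q' :=
    ObjectProperty.homMk (StructuredArrow.homMk p.hom.right ((functionsSpecCone A).w p))
  let c (s : Cone (quotientDiagram B)) : Cone (quotientDiagram A) :=
    { pt := s.pt
      π :=
        { app := fun q => s.π.app (ext q)
          naturality := fun q q' p => (Category.id_comp _).trans (s.w (extMap p)).symm } }
  have hres : ∀ q' : (isQuotient B).FullSubcategory,
      ∃ q : (isQuotient A).FullSubcategory, Nonempty (ext q ⟶ q') := by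
    intro q'
    let x : A ⟶ (quasiCoherent R).obj q'.obj.right := η ≫ q'.obj.hom
    obtain ⟨Q, k, hQ, _⟩ := exists_quotient_factorization hA x
    -- Affineness enters here: the two morphisms out of `𝔸_{Spec A}` agree because they agree on
    -- `A`.
    have hk : π Q ≫ (quasiCoherent R).map k = q'.obj.hom := by
      refine hom_ext_of_toFunctionsSpec_comp (A := A) ?_
      exact (Category.assoc _ _ _).symm.trans
        ((congrArg (fun y => y ≫ (quasiCoherent R).map k) (hπ Q)).trans hQ)
    exact ⟨Q, ⟨ObjectProperty.homMk (StructuredArrow.homMk k hk)⟩⟩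
  exact ⟨{
    lift := fun s => hL.lift (c s)
    fac := fun s q' => by
      obtain ⟨q, ⟨j⟩⟩ := hres q'
      have h1 : hL.lift (c s) ≫ (quotientCone B).π.app (ext q) = s.π.app (ext q) :=
        hL.fac (c s) q
      rw [← (quotientCone B).w j, ← s.w j, ← h1]
      exact (Category.assoc _ _ _).symm
    uniq := fun s m hm => hL.uniq (c s) m fun q => hm (ext q) }⟩

variable (R) in
/-- `A ↦ Spec A` on pro-quasicoherent functors of algebras in `𝔉`. -/
abbrev specRestricted :
    (proQuasicoherentFree R).FullSubcategoryᵒᵖ ⥤ (affineFree R).FullSubcategory :=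
  (affineFree R).lift ((proQuasicoherentFree R).ι.op ⋙ specFunctor R)
    (fun A => affineFree_spec A.unop.property)

variable (R) in
/-- `X ↦ 𝔸_X` on affine functors with `𝔸_X ∈ 𝔉`. -/
abbrev functionsRestricted :
    (affineFree R).FullSubcategory ⥤ (proQuasicoherentFree R).FullSubcategoryᵒᵖ :=
  ((proQuasicoherentFree R).lift ((affineFree R).ι.op ⋙ functionsFunctor R)
    (fun X => proQuasicoherentFree_functions X.unop.property)).rightOp

/-- The canonical isomorphism `A = 𝔸_{Spec A}` for `A` pro-quasicoherent in `𝔉`. -/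
def functionsSpecIso (A : (proQuasicoherentFree R).FullSubcategory) :
    A ≅ ((functionsRestricted R).obj ((specRestricted R).obj (op A))).unop :=
  have := isIso_toFunctionsSpec_of_isProQuasicoherent A.property.2 A.property.1
  (proQuasicoherentFree R).isoMk (asIso (toFunctionsSpec A.obj))

/-- The canonical isomorphism `X = Spec 𝔸_X` for `X` affine. -/
def specFunctionsIso (X : (affineFree R).FullSubcategory) :
    X ≅ (specRestricted R).obj ((functionsRestricted R).obj X) :=
  have := X.property.1.1
  (affineFree R).isoMk (asIso (toSpecFunctions X.obj))

theorem functionsSpecIso_naturality {A B : (proQuasicoherentFree R).FullSubcategory} (f : A ⟶ B) :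
    f ≫ (functionsSpecIso B).hom = (functionsSpecIso A).hom ≫
      ((functionsRestricted R).map ((specRestricted R).map f.op)).unop :=
  ObjectProperty.hom_ext _ (toFunctionsSpec_naturality f.hom)

theorem specFunctionsIso_naturality {X Y : (affineFree R).FullSubcategory} (p : X ⟶ Y) :
    p ≫ (specFunctionsIso Y).hom = (specFunctionsIso X).hom ≫
      (specRestricted R).map ((functionsRestricted R).map p) :=
  ObjectProperty.hom_ext _ (toSpecFunctions_naturality p.hom)

variable (R) in
/-- The anti-equivalence between pro-quasicoherent functors of algebras in `𝔉` and affine functors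
with algebra of functions in `𝔉`. -/
def specEquivalence :
    (proQuasicoherentFree R).FullSubcategoryᵒᵖ ≌ (affineFree R).FullSubcategory :=
  CategoryTheory.Equivalence.mk (specRestricted R) (functionsRestricted R)
    (NatIso.ofComponents (fun A => (functionsSpecIso A.unop).symm.op) (fun {A B} f =>
      Quiver.Hom.unop_inj ((functionsSpecIso A.unop).eq_comp_inv.2
        ((Category.assoc _ _ _).trans ((functionsSpecIso B.unop).inv_comp_eq.2
          (functionsSpecIso_naturality f.unop))))))
    (NatIso.ofComponents (fun X => (specFunctionsIso X).symm) (fun {X Y} p =>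
      ((specFunctionsIso X).eq_inv_comp.2 ((Category.assoc _ _ _).symm.trans
        ((specFunctionsIso Y).comp_inv_eq.2 (specFunctionsIso_naturality p).symm)))))

end Duality

end

theorem mainTheorem10 (R : Type u) [CommRing R] :
    -- for every functor of commutative algebras `A ∈ 𝔉`
    (∀ A : AlgFunctor R, A.toModFunctor.IsEssentiallyFree →
      -- `Spec A` is the direct limit of the `Spec 𝓐_i`
      Nonempty (IsColimit ((specFunctor R).mapCocone (quotientCone A).op)) ∧
      -- `𝓐_i = 𝔸_{Spec 𝓐_i}` and, with these identifications, `𝔸_{Spec A}` is the inverse limit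
      -- of the `𝓐_i`
      (∃ e : quotientDiagram A ≅ quotientDiagram A ⋙ (specFunctor R).rightOp ⋙ functionsFunctor R,
        (∀ q, e.hom.app q = toFunctionsSpec ((quotientDiagram A).obj q)) ∧
        Nonempty (IsLimit ((Cone.postcompose e.inv).obj
          (((specFunctor R).rightOp ⋙ functionsFunctor R).mapCone (quotientCone A))))) ∧
      -- if `Spec A` is affine, then `𝔸_{Spec A}` is pro-quasicoherent
      (IsAffineFunctor ((specFunctor R).obj (op A)) →
        IsProQuasicoherent ((functionsFunctor R).obj (op ((specFunctor R).obj (op A)))))) ∧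
    -- `A ↦ Spec A` and `X ↦ 𝔸_X` are mutually inverse anti-equivalences
    (∃ (hSpec : ∀ A, proQuasicoherentFree R A → affineFree R ((specFunctor R).obj (op A)))
      (hFun : ∀ X, affineFree R X → proQuasicoherentFree R ((functionsFunctor R).obj (op X)))
      (E : (proQuasicoherentFree R).FullSubcategoryᵒᵖ ≌ (affineFree R).FullSubcategory),
      E.functor = (affineFree R).lift ((proQuasicoherentFree R).ι.op ⋙ specFunctor R)
        (fun A => hSpec _ A.unop.property) ∧
      E.inverse = ((proQuasicoherentFree R).lift ((affineFree R).ι.op ⋙ functionsFunctor R)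
        (fun X => hFun _ X.unop.property)).rightOp) ∧
    -- the canonical morphism `A → 𝔸_{Spec A}` is an isomorphism
    (∀ A, proQuasicoherentFree R A → IsIso (toFunctionsSpec A)) := by
  refine ⟨fun A hA => ⟨⟨isColimitSpecQuotientCone hA⟩, ?_, fun h => ?_⟩, ?_, fun A hA => ?_⟩
  · exact ⟨quotientDiagramIso A, quotientDiagramIso_hom_app A,
      ⟨isLimitFunctionsSpecCone (isColimitSpecQuotientCone hA)⟩⟩
  · exact isProQuasicoherent_functions_spec hA h.1
  · exact ⟨fun _ => affineFree_spec, fun _ => proQuasicoherentFree_functions, specEquivalence R,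
      rfl, rfl⟩
  · exact isIso_toFunctionsSpec_of_isProQuasicoherent hA.2 hA.1
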